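/- For integers $n\ge 5$ and $1<s<n/2$ let $C_n(1,s)$ be the graph on $\mathbb Z_n$ in which $x,y$ are adjacent iff $x-y\in\{\pm1,\pm s\}$. An all-to-all routing $R$ of a graph $G$ consists of one oriented path $P_{x,y}$ from $x$ to $y$ for every ordered pair of distinct vertices. Let $\pi(G,R)$ be the maximum, over the edges $e$, of the number of paths of $R$ using $e$ (in either direction), and $\overrightarrow{\pi}(G,R)$ the maximum, over the arcs $a$ (ordered pairs of adjacent vertices), of the number of paths of $R$ using $a$ along its direction; let $\pi(G)=\min_R\pi(G,R)$ and $\overrightarrow{\pi}(G)=\min_R\overrightarrow{\pi}(G,R)$ be the edge- and arc-forwarding indices. Let $\mathcal R_{n,s}=\{P_{x,y}: x,y\in\mathbb Z_n,\ x\neq y\}$ be the following routing of $C_n(1,s)$. For $1\le d\le\lfloor n/2\rfloor$ write $d=is+j$ with $0\le j\le s-1$; if $j\le\lfloor s/2\rfloor$, let $P_{0,d}$ be $0,s,2s,\dots,is,is+1,\dots,is+j$, and if $j>\lfloor s/2\rfloor$, let $P_{0,d}$ be $0,s,2s,\dots,(i+1)s,(i+1)s-1,\dots,(i+1)s-(s-j)$.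 For $\lfloor n/2\rfloor<d\le n-1$ let $P_{0,d}$ be obtained from $P_{0,n-d}$ by negating every vertex. For all $x\ne y$ in $\mathbb Z_n$ let $P_{x,y}$ be obtained from $P_{0,d}$, $d\in\{1,\dots,n-1\}$, $d\equiv y-x \pmod n$, by adding $x$ to every vertex. Then there are an algorithm (a program for a register machine whose unit-cost instructions are constants, addition, truncated subtraction, comparison and output of natural numbers), a polynomial $T$ and an integer $N$ such that for all integers $n\ge N$ and $2\le s\le\sqrt{3n/2}$: the algorithm on input $(n,s)$ halts after at most $T(n)$ steps and outputs $\mathcal R_{n,s}$ (the vertex lists of all its paths); $\mathcal R_{n,s}$ is an all-to-all routing of $C_n(1,s)$; and $$\pi(C_n(1,s),\mathcal R_{n,s})\le \tfrac32\,\pi(C_n(1,s)),\qquad \overrightarrow{\pi}(C_n(1,s),\mathcal R_{n,s})\le \tfrac32\,\overrightarrow{\pi}(C_n(1,s)).$$ That is, the construction is a $1.5$-factor approximation algorithm for the edge- and arc-forwarding index problems on $C_n(1,s)$ with $n$ sufficiently large and $2\le s\le\sqrt{3n/2}$. -/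

import Mathlib

namespace Forwarding

/-! ### All-to-all routings, loads and forwarding indices of a graph -/

section Graphs

variable {V : Type*} {G : SimpleGraph V}

/-- An all-to-all routing of `G`: one oriented path from `x` to `y` for every ordered pair of
distinct vertices. -/
def Routing (G : SimpleGraph V) : Type _ := ∀ x y : V, x ≠ y → G.Path x y

/-- The load of the edge `e`: the number of paths of `R` that use `e`, in either direction. -/
noncomputable def Routing.edgeLoad (R : Routing G) (e : Sym2 V) : ℕ :=
  Set.ncard {p : V × V | ∃ h : p.1 ≠ p.2, e ∈ (R p.1 p.2 h).1.edges}

/-- The load of the arc `a`: the number of paths of `R` that use `a` along its direction. -/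
noncomputable def Routing.arcLoad (R : Routing G) (a : G.Dart) : ℕ :=
  Set.ncard {p : V × V | ∃ h : p.1 ≠ p.2, a ∈ (R p.1 p.2 h).1.darts}

/-- `π(G, R)`: the maximum load of an edge (`G` is finite wherever this is used). -/
noncomputable def Routing.maxEdgeLoad (R : Routing G) : ℕ := ⨆ e : G.edgeSet, R.edgeLoad e

/-- The maximum load of an arc (`G` is finite wherever this is used). -/
noncomputable def Routing.maxArcLoad (R : Routing G) : ℕ := ⨆ a : G.Dart, R.arcLoad a

/-- The edge-forwarding index `π(G)`: the minimum of `π(G, R)` over all routings `R`. -/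
noncomputable def edgeForwardingIndex (G : SimpleGraph V) : ℕ :=
  ⨅ R : Routing G, R.maxEdgeLoad

/-- The arc-forwarding index: the minimum of the maximum arc load over all routings `R`. -/
noncomputable def arcForwardingIndex (G : SimpleGraph V) : ℕ :=
  ⨅ R : Routing G, R.maxArcLoad

end Graphs

/-! ### The circulant graph `C_n(1, s)` and its routing -/

/-- `C_n(1, s)`: vertex set `ℤ/nℤ`, with `x`, `y` adjacent iff `x - y ∈ {1, -1, s, -s}`
(and `x ≠ y`, which follows from this membership when `1 < s < n / 2`). -/
def circulant (n s : ℕ) : SimpleGraph (ZMod n) :=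
  SimpleGraph.circulantGraph ({1, -1, (s : ZMod n), -(s : ZMod n)} : Set (ZMod n))

/-- The list of vertices, as natural numbers, of the path from `0` to `d = i * s + j`
(`0 ≤ j < s`), for `1 ≤ d ≤ ⌊n / 2⌋`:
* if `j ≤ ⌊s / 2⌋`: `0, s, 2s, …, is, is + 1, …, is + j`;
* if `j > ⌊s / 2⌋`: `0, s, 2s, …, (i+1)s, (i+1)s - 1, …, (i+1)s - (s - j)`. -/
def forwardPath (s d : ℕ) : List ℕ :=
  let i := d / s
  let j := d % s
  if j ≤ s / 2 then
    (List.range (i + 1)).map (fun k => k * s) ++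
      (List.range j).map (fun k => i * s + (k + 1))
  else
    (List.range (i + 2)).map (fun k => k * s) ++
      (List.range (s - j)).map (fun k => (i + 1) * s - (k + 1))

/-- The list of vertices of the path `P_{0,d}` for `1 ≤ d ≤ n - 1`: the path above if
`d ≤ ⌊n / 2⌋`, and the negative of the path `P_{0,n-d}` otherwise. -/
def pathFromZero (n s d : ℕ) : List (ZMod n) :=
  if d ≤ n / 2 then (forwardPath s d).map (fun v => (v : ZMod n))
  else (forwardPath s (n - d)).map (fun v => -(v : ZMod n))

/-- The list of vertices of the path `P_{x,y}`, `x ≠ y`: the translate by `x` of `P_{0,y-x}`. -/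
def routePath (n s : ℕ) (x y : ZMod n) : List (ZMod n) :=
  (pathFromZero n s (y - x).val).map (fun v => x + v)

/-- A routing of a graph on `ℤ/nℤ` written out as one list of natural numbers: for all pairs
`x ≠ y` of `{0, …, n-1}` in lexicographic order, the vertices (as numbers in `{0, …, n-1}`) of the
path from `x` to `y` in their order along the path, followed by the end marker `n`. -/
def Routing.encode {n : ℕ} {G : SimpleGraph (ZMod n)} (R : Routing G) : List ℕ :=
  (List.range n).flatMap fun x => (List.range n).flatMap fun y =>
    if h : (x : ZMod n) ≠ (y : ZMod n) then (R x y h).1.support.map ZMod.val ++ [n] else []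

/-! ### Algorithms: register programs with a step count -/

/-- Programs over registers `0, 1, 2, …` that hold natural numbers, with a write-only output.
Addition and truncated subtraction are the only arithmetic operations (no multiplication, so that
after `t` steps the numbers have `O(t)` more bits than the input, and counting
each instruction as one step agrees with Turing machine time up to a polynomial). -/
inductive Program : Type
  /-- `r_i := c` -/
  | const (i c : ℕ)
  /-- `r_i := r_j + r_k` -/
  | add (i j k : ℕ)
  /-- `r_i := r_j - r_k`, truncated at `0` -/
  | sub (i j k : ℕ)
  /-- append `r_i` to the output -/
  | write (i : ℕ)
  /-- first `p`, then `q` -/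
  | seq (p q : Program)
  /-- if `r_i < r_j` then `p` else `q` -/
  | ite (i j : ℕ) (p q : Program)
  /-- while `r_i < r_j` do `p` -/
  | loop (i j : ℕ) (p : Program)

/-- The contents of the registers, and the output written so far. -/
structure State where
  reg : ℕ → ℕ
  out : List ℕ

/-- The state with `v` stored in register `i`. -/
def State.set (σ : State) (i v : ℕ) : State := ⟨Function.update σ.reg i v, σ.out⟩

/-- `Runs p σ t τ`: the program `p`, started in the state `σ`, halts after exactly `t` steps in the
state `τ`. Each assignment, each output instruction and each evaluation of a comparison is one
step. -/
inductive Runs : Program → State → ℕ → State → Prop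
  | const (i c : ℕ) (σ : State) : Runs (.const i c) σ 1 (σ.set i c)
  | add (i j k : ℕ) (σ : State) : Runs (.add i j k) σ 1 (σ.set i (σ.reg j + σ.reg k))
  | sub (i j k : ℕ) (σ : State) : Runs (.sub i j k) σ 1 (σ.set i (σ.reg j - σ.reg k))
  | write (i : ℕ) (σ : State) : Runs (.write i) σ 1 ⟨σ.reg, σ.out ++ [σ.reg i]⟩
  | seq {p q : Program} {σ τ υ : State} {t u : ℕ} :
      Runs p σ t τ → Runs q τ u υ → Runs (.seq p q) σ (t + u) υ
  | iteTrue {i j : ℕ} {p q : Program} {σ τ : State} {t : ℕ} :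
      σ.reg i < σ.reg j → Runs p σ t τ → Runs (.ite i j p q) σ (t + 1) τ
  | iteFalse {i j : ℕ} {p q : Program} {σ τ : State} {t : ℕ} :
      ¬ σ.reg i < σ.reg j → Runs q σ t τ → Runs (.ite i j p q) σ (t + 1) τ
  | loopTrue {i j : ℕ} {p : Program} {σ τ υ : State} {t u : ℕ} :
      σ.reg i < σ.reg j → Runs p σ t τ → Runs (.loop i j p) τ u υ →
        Runs (.loop i j p) σ (t + u + 1) υ
  | loopFalse {i j : ℕ} {p : Program} {σ : State} :
      ¬ σ.reg i < σ.reg j → Runs (.loop i j p) σ 1 σ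

/-- The initial state on input `(n, s)`: `n` in register `0`, `s` in register `1`, zero in all other
registers, empty output. -/
def State.init (n s : ℕ) : State := ⟨fun i => if i = 0 then n else if i = 1 then s else 0, []⟩

/-- On input `(n, s)` the program `p` halts after at most `T` steps with output `w`. -/
def Computes (p : Program) (n s T : ℕ) (w : List ℕ) : Prop :=
  ∃ (t : ℕ) (τ : State), Runs p (State.init n s) t τ ∧ t ≤ T ∧ τ.out = w

end Forwarding

namespace Forwarding

open Finset

/-! ### Loads of edges and arcs, and double counting. -/

section General

variable {V : Type*} {G : SimpleGraph V}

/-! The routing is compared with two lower bounds that hold for every routing, one for each kind of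
arc. It is translation invariant, so the load of an arc depends only on its step `c`: it is at most
the number of pairs `(d, k)` for which the `k`-th step of the path from `0` to `d` is `c`
(`FollowsRoute.arcLoad_le`). This gives at most `∑ longSteps s d`, about `n² / (8s)`, on the arcs
`±s`, and at most `∑ unitSteps s d`, about `ns / 8`, on the arcs `±1`, the sums being over `d ≤ n /
2`.

The long arcs are matched by a cut (`Routing.cut_bounds`): at most `2(s + 1)` arcs leave the first
`⌊n / 2⌋` vertices, so some arc has load at least about `n² / (8(s + 1))`. The ratio is `(s + 1) / s
≤ 3 / 2`.

The unit arcs are matched by distances (`Routing.ball_bounds`): at most `2k² + 2k + 1` vertices lie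
within distance `k` of a given one, while there are at most `4n` arcs to share the total length of
all paths. Counting distances up to `K = ⌊s / 2⌋` shows that some arc has load at least about `ns /
8 - s³ / 48`. Since `s² ≤ 3n / 2`, the ratio is at most about `4 / 3`; the gap to `3 / 2` absorbs
the rounding errors for large `n`. Adding the two directions gives the same comparison for edges.

For the algorithm, division with remainder by `s` is a loop of subtractions, each of which outputs
one vertex. Step counts and correctness are carried together through a total-correctness calculus
(`WP`). -/

theorem finite_dart [Finite V] (G : SimpleGraph V) : Finite G.Dart :=
  Finite.of_injective SimpleGraph.Dart.toProd SimpleGraph.Dart.toProd_injective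

/-- A path repeats no edge. Hence the two directions of an edge are loaded by disjoint sets of
paths, and `Routing.edgeLoad_eq` is an equality. -/
theorem not_mem_darts_symm {x y : V} (p : G.Path x y) {a : G.Dart} (ha : a ∈ p.1.darts) :
    a.symm ∉ p.1.darts := by
  intro hb
  have h : (p.1.darts.map SimpleGraph.Dart.edge).Nodup := p.2.isTrail.edges_nodup
  have := List.inj_on_of_nodup_map h ha hb (a.edge_symm).symm
  exact a.symm_ne this.symm

theorem edge_mem_edges_iff {x y : V} (p : G.Walk x y) (a : G.Dart) :
    a.edge ∈ p.edges ↔ a ∈ p.darts ∨ a.symm ∈ p.darts := by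
  rw [SimpleGraph.Walk.edges_eq_map_darts, List.mem_map]
  constructor
  · rintro ⟨b, hb, hba⟩
    rcases (SimpleGraph.dart_edge_eq_iff b a).1 hba with rfl | rfl
    · exact Or.inl hb
    · exact Or.inr hb
  · rintro (h | h)
    · exact ⟨a, h, rfl⟩
    · exact ⟨_, h, a.edge_symm⟩

theorem Routing.edgeLoad_eq [Finite V] (R : Routing G) (a : G.Dart) :
    R.edgeLoad a.edge = R.arcLoad a + R.arcLoad a.symm := by
  unfold Routing.edgeLoad Routing.arcLoad
  rw [← Set.ncard_union_eq _ (Set.toFinite _) (Set.toFinite _)]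
  · congr 1
    ext p
    simp only [Set.mem_ofPred_eq, Set.mem_union, edge_mem_edges_iff, ← exists_or]
  · rw [Set.disjoint_left]
    rintro p ⟨h, hp⟩ ⟨_, hq⟩
    exact not_mem_darts_symm _ hp hq

theorem Routing.arcLoad_le [Finite V] (R : Routing G) (a : G.Dart) :
    R.arcLoad a ≤ R.maxArcLoad := by
  have := finite_dart G
  exact le_ciSup (f := fun a : G.Dart => R.arcLoad a) (Set.finite_range _).bddAbove a

theorem Routing.edgeLoad_le [Finite V] (R : Routing G) (a : G.Dart) :
    R.edgeLoad a.edge ≤ R.maxEdgeLoad :=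
  le_ciSup (f := fun e : G.edgeSet => R.edgeLoad e) (Set.finite_range _).bddAbove
    ⟨a.edge, a.edge_mem⟩

theorem Routing.sum_arcLoad_le [Finite V] (R : Routing G) (A : Finset G.Dart) :
    ∑ a ∈ A, R.arcLoad a ≤ #A * R.maxArcLoad := by
  simpa using Finset.sum_le_card_nsmul A _ _ fun a _ => R.arcLoad_le a

theorem Routing.sum_arcLoad_symm_le [Finite V] (R : Routing G) (A : Finset G.Dart) :
    ∑ a ∈ A, R.arcLoad a + ∑ a ∈ A, R.arcLoad a.symm ≤ #A * R.maxEdgeLoad := by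
  rw [← Finset.sum_add_distrib]
  simpa using Finset.sum_le_card_nsmul A _ _ fun a _ =>
    (R.edgeLoad_eq a).symm.trans_le (R.edgeLoad_le a)

open Classical in
/-- The number of arcs of `A` on the path from `x` to `y`. -/
noncomputable def Routing.uses (R : Routing G) (A : Finset G.Dart) (x y : V) : ℕ :=
  if h : x = y then 0 else #(A.filter (· ∈ (R x y h).1.darts))

theorem Routing.sum_arcLoad_eq [Fintype V] (R : Routing G) (A : Finset G.Dart) :
    ∑ a ∈ A, R.arcLoad a = ∑ x, ∑ y, R.uses A x y := by
  classical
  rw [← Fintype.sum_prod_type' (f := R.uses A)]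
  let r : V × V → G.Dart → Prop := fun p a => ∃ h : p.1 ≠ p.2, a ∈ (R p.1 p.2 h).1.darts
  have h := Finset.sum_card_bipartiteAbove_eq_sum_card_bipartiteBelow (s := univ) (t := A) r
  have h1 : ∀ a, R.arcLoad a = #(univ.bipartiteBelow r a) := by
    intro a
    rw [Routing.arcLoad, Set.ncard_eq_toFinset_card']
    congr 1
    ext p
    simp [r, Finset.mem_bipartiteBelow]
  have h2 : ∀ p : V × V, R.uses A p.1 p.2 = #(A.bipartiteAbove r p) := by
    rintro ⟨x, y⟩
    unfold Routing.uses
    split_ifs with hxy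
    · symm
      simp only [Finset.card_eq_zero]
      ext a
      simp only [Finset.mem_bipartiteAbove, r]
      simp only [Finset.notMem_empty, iff_false, not_and, not_exists]
      exact fun _ h => absurd hxy h
    · congr 1
      ext a
      simp only [Finset.mem_bipartiteAbove, r, Finset.mem_filter]
      exact ⟨fun h => ⟨h.1, hxy, h.2⟩, fun h => ⟨h.1, h.2.2⟩⟩
  rw [Finset.sum_congr rfl fun a _ => h1 a, ← h]
  exact Finset.sum_congr rfl fun p _ => (h2 p).symm

/-- Every path from `S` to its complement contains an arc that leaves `S`. -/
theorem Routing.card_mul_card_le [Fintype V] (R : Routing G) (S : Finset V) (A : Finset G.Dart)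
    [DecidableEq V] (hA : ∀ a : G.Dart, a.fst ∈ S → a.snd ∉ S → a ∈ A) :
    #S * #(Sᶜ) ≤ ∑ a ∈ A, R.arcLoad a := by
  classical
  rw [R.sum_arcLoad_eq]
  calc #S * #(Sᶜ) = ∑ x ∈ S, ∑ y ∈ Sᶜ, 1 := by simp
    _ ≤ ∑ x ∈ S, ∑ y ∈ Sᶜ, R.uses A x y := by
        refine Finset.sum_le_sum fun x hx => Finset.sum_le_sum fun y hy => ?_
        rw [Finset.mem_compl] at hy
        have hxy : x ≠ y := fun h => hy (h ▸ hx)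
        rw [Routing.uses, dif_neg hxy, Nat.one_le_iff_ne_zero, Finset.card_ne_zero]
        obtain ⟨a, ha, h1, h2⟩ := (R x y hxy).1.exists_boundary_dart (S : Set V)
          (by simpa using hx) (by simpa using hy)
        exact ⟨a, by simpa [ha] using hA a (by simpa using h1) (by simpa using h2)⟩
    _ ≤ ∑ x, ∑ y, R.uses A x y := by
        refine (Finset.sum_le_sum fun x _ => Finset.sum_le_univ_sum_of_nonneg fun _ => zero_le).trans
          (Finset.sum_le_univ_sum_of_nonneg fun _ => zero_le)

theorem Routing.uses_univ [Fintype G.Dart] (R : Routing G) {x y : V} (h : x ≠ y) :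
    R.uses univ x y = (R x y h).1.length := by
  classical
  rw [Routing.uses, dif_neg h, ← SimpleGraph.Walk.length_darts,
    ← List.toFinset_card_of_nodup
      (SimpleGraph.Walk.darts_nodup_of_support_nodup (R x y h).2.support_nodup)]
  congr 1
  ext a
  simp

theorem exists_walk_of_adj (f : ℕ → V) (m : ℕ) (hf : ∀ k < m, G.Adj (f k) (f (k + 1))) :
    ∃ p : G.Walk (f 0) (f m), p.support = (List.range (m + 1)).map f ∧
      ∀ a ∈ p.darts, ∃ k < m, a.fst = f k ∧ a.snd = f (k + 1) := by
  induction m with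
  | zero => exact ⟨.nil, by simp, by simp⟩
  | succ m ih =>
    obtain ⟨p, hp, hd⟩ := ih fun k hk => hf k (hk.trans m.lt_succ_self)
    refine ⟨p.concat (hf m m.lt_succ_self), ?_, ?_⟩
    · rw [SimpleGraph.Walk.support_concat, hp, List.range_succ (n := m + 1)]
      simp
    · intro a ha
      rw [SimpleGraph.Walk.darts_concat] at ha
      rw [List.concat_eq_append, List.mem_append, List.mem_singleton] at ha
      rcases ha with ha | rfl
      · obtain ⟨k, hk, h⟩ := hd a ha
        exact ⟨k, hk.trans m.lt_succ_self, h⟩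
      · exact ⟨m, m.lt_succ_self, rfl, rfl⟩

end General

/-! ### Lower bounds for an arbitrary routing of `C_n(1, s)`: cuts and distances. -/

section Circulant

variable {n s : ℕ}

theorem circulant_adj_sub {x y : ZMod n} (h : (circulant n s).Adj x y) :
    y - x ∈ ({1, -1, (s : ZMod n), -(s : ZMod n)} : Finset (ZMod n)) := by
  simp only [circulant, SimpleGraph.circulantGraph_adj, Set.mem_insert_iff,
    Set.mem_singleton_iff] at h
  simp only [Finset.mem_insert, Finset.mem_singleton]
  have e : y - x = -(x - y) := by ring
  rcases h with ⟨-, (h | h | h | h) | h⟩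
  · rw [e, h]; simp
  · rw [e, h]; simp
  · rw [e, h]; simp
  · rw [e, h]; simp
  · exact h

theorem card_cut_le [NeZero n] {m : ℕ} (hm : m ≤ n) (A : Finset (circulant n s).Dart)
    (hA : ∀ a ∈ A, a.fst.val < m ∧ ¬ a.snd.val < m) : #A ≤ 2 * (s + 1) := by
  classical
  -- An arc is determined by its tail and its step. The step `1` leaves `{0, …, m - 1}` only from
  -- the last vertex and `-1` only from the first; the steps `s` and `-s` only from the last and the
  -- first `s` vertices.
  let U : Finset (ZMod n × ZMod n) :=
    ((Ico (m - 1) m).image (fun v : ℕ => ((v : ZMod n), (v : ZMod n) + 1)) ∪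
      (range 1).image (fun v : ℕ => ((v : ZMod n), (v : ZMod n) - 1))) ∪
    ((Ico (m - s) m).image (fun v : ℕ => ((v : ZMod n), (v : ZMod n) + s)) ∪
      (range s).image (fun v : ℕ => ((v : ZMod n), (v : ZMod n) - s)))
  have hU : #U ≤ 2 * (s + 1) := by
    refine (card_union_le _ _).trans ?_
    have h1 := card_union_le ((Ico (m - 1) m).image (fun v : ℕ => ((v : ZMod n), (v : ZMod n) + 1)))
      ((range 1).image (fun v : ℕ => ((v : ZMod n), (v : ZMod n) - 1)))
    have h2 := card_union_le ((Ico (m - s) m).image (fun v : ℕ => ((v : ZMod n), (v : ZMod n) + s)))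
      ((range s).image (fun v : ℕ => ((v : ZMod n), (v : ZMod n) - s)))
    have h3 := card_image_le (s := Ico (m - 1) m) (f := fun v : ℕ => ((v : ZMod n), (v : ZMod n) + 1))
    have h4 := card_image_le (s := range 1) (f := fun v : ℕ => ((v : ZMod n), (v : ZMod n) - 1))
    have h5 := card_image_le (s := Ico (m - s) m) (f := fun v : ℕ => ((v : ZMod n), (v : ZMod n) + s))
    have h6 := card_image_le (s := range s) (f := fun v : ℕ => ((v : ZMod n), (v : ZMod n) - s))
    simp only [Nat.card_Ico, card_range] at h3 h4 h5 h6
    omega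
  refine le_trans ?_ hU
  refine card_le_card_of_injOn SimpleGraph.Dart.toProd ?_
    (SimpleGraph.Dart.toProd_injective.injOn)
  intro a ha
  obtain ⟨h1, h2⟩ := hA a ha
  have hc := circulant_adj_sub a.adj
  obtain ⟨⟨x, y⟩, hxy⟩ := a
  simp only at h1 h2 hc
  have hx : ((x.val : ℕ) : ZMod n) = x := ZMod.natCast_zmod_val x
  have hv : ∀ w : ℕ, w < m → (w : ZMod n) = y → False := by
    rintro w hw rfl
    rw [ZMod.val_cast_of_lt (by omega)] at h2
    exact h2 hw
  simp only [Finset.mem_insert, Finset.mem_singleton, sub_eq_iff_eq_add] at hc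
  simp only [U, coe_union, coe_image, Set.mem_union, Set.mem_image, Finset.mem_coe, mem_Ico,
    mem_range, Prod.mk.injEq]
  rcases hc with hc | hc | hc | hc
  · refine Or.inl (Or.inl ⟨x.val, ⟨?_, h1⟩, hx, by rw [hx, hc]; ring⟩)
    by_contra hlt
    exact hv (x.val + 1) (by omega) (by push_cast; rw [hx, hc]; ring)
  · refine Or.inl (Or.inr ⟨x.val, ?_, hx, by rw [hx, hc]; ring⟩)
    by_contra hlt
    exact hv (x.val - 1) (by omega) (by rw [Nat.cast_sub (by omega), hx, hc]; push_cast; ring)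
  · refine Or.inr (Or.inl ⟨x.val, ⟨?_, h1⟩, hx, by rw [hx, hc]; ring⟩)
    by_contra hlt
    exact hv (x.val + s) (by omega) (by push_cast; rw [hx, hc]; ring)
  · refine Or.inr (Or.inr ⟨x.val, ?_, hx, by rw [hx, hc]; ring⟩)
    by_contra hlt
    exact hv (x.val - s) (by omega) (by rw [Nat.cast_sub (by omega), hx, hc]; ring)

theorem card_val_lt [NeZero n] {m : ℕ} (hm : m ≤ n) :
    #(univ.filter fun x : ZMod n => x.val < m) = m := by
  have : (univ.filter fun x : ZMod n => x.val < m) = (range m).image (fun v : ℕ => (v : ZMod n)) := by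
    ext x
    simp only [mem_filter, mem_univ, true_and, mem_image, mem_range]
    constructor
    · exact fun h => ⟨x.val, h, ZMod.natCast_zmod_val x⟩
    · rintro ⟨v, hv, rfl⟩
      rwa [ZMod.val_cast_of_lt (by omega)]
  rw [this, card_image_of_injOn, card_range]
  intro v hv w hw h
  simp only [coe_range, Set.mem_Iio] at hv hw
  have := congrArg ZMod.val h
  simpa [ZMod.val_cast_of_lt (show v < n by omega), ZMod.val_cast_of_lt (show w < n by omega)]
    using this

/-- Lower bounds for the loads of an arbitrary routing, from the cut between `{0, …, m - 1}` and
its complement. -/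
theorem Routing.cut_bounds [NeZero n] {m : ℕ} (hm : m ≤ n) (R : Routing (circulant n s)) :
    m * (n - m) ≤ 2 * (s + 1) * R.maxArcLoad ∧ m * (n - m) ≤ (s + 1) * R.maxEdgeLoad := by
  classical
  have := finite_dart (circulant n s)
  have := Fintype.ofFinite (circulant n s).Dart
  let S : Finset (ZMod n) := univ.filter fun x : ZMod n => x.val < m
  let A : Finset (circulant n s).Dart := univ.filter fun a => a.fst ∈ S ∧ a.snd ∉ S
  have hS : #S = m := card_val_lt hm
  have hSc : #(Sᶜ) = n - m := by rw [card_compl, hS, ZMod.card]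
  have hA : #A ≤ 2 * (s + 1) := by
    refine card_cut_le hm A fun a ha => ?_
    simpa [A, S] using ha
  have h1 := R.card_mul_card_le S A fun a h h' => by simp [A, h, h']
  -- The reversed arcs of `A` carry the pairs in the opposite direction; both directions together
  -- load the edges of the cut.
  have h2 := R.card_mul_card_le Sᶜ (A.image SimpleGraph.Dart.symm) fun a h h' => by
    rw [mem_image]
    refine ⟨a.symm, ?_, a.symm_symm⟩
    rw [mem_compl] at h h'
    rw [not_not] at h'
    simp only [A, mem_filter, mem_univ, true_and]
    exact ⟨h', h⟩
  rw [sum_image fun a _ b _ h => SimpleGraph.Dart.symm_involutive.injective h, compl_compl] at h2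
  rw [hS, hSc] at h1 h2
  have h3 := R.sum_arcLoad_le A
  have h4 := R.sum_arcLoad_symm_le A
  constructor
  · exact (h1.trans h3).trans (Nat.mul_le_mul_right _ hA)
  · have h5 := Nat.mul_le_mul_right R.maxEdgeLoad hA
    rw [mul_comm] at h2
    have h6 : 2 * (s + 1) * R.maxEdgeLoad = 2 * ((s + 1) * R.maxEdgeLoad) := by ring
    omega

/-- Induction on the radius: the `ℓ¹` sphere of radius `k + 1` in `ℤ²` consists of four sides of `k
+ 1` points each, listed in `C`. Passing to `ZMod n` can only identify points. -/
theorem card_l1_ball_le (n s k : ℕ) : ∃ B : Finset (ZMod n), #B ≤ 2 * k ^ 2 + 2 * k + 1 ∧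
    ∀ a b : ℤ, a.natAbs + b.natAbs ≤ k → (a : ZMod n) + b * s ∈ B := by
  classical
  induction k with
  | zero =>
    refine ⟨{0}, by simp, fun a b h => ?_⟩
    obtain rfl : a = 0 := by omega
    obtain rfl : b = 0 := by omega
    simp
  | succ k ih =>
    obtain ⟨B, hB, h⟩ := ih
    let g : ℤ × ℤ → ZMod n := fun p => (p.1 : ZMod n) + p.2 * s
    let C : Finset (ℤ × ℤ) := ((range (k + 1)).image (fun i : ℕ => ((i : ℤ), (k : ℤ) + 1 - i)) ∪
      (range (k + 1)).image (fun i : ℕ => ((k : ℤ) + 1 - i, -(i : ℤ)))) ∪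
      ((range (k + 1)).image (fun i : ℕ => (-(i : ℤ), -((k : ℤ) + 1 - i))) ∪
      (range (k + 1)).image (fun i : ℕ => (-((k : ℤ) + 1 - i), (i : ℤ))))
    have hC : #C ≤ 4 * (k + 1) := by
      have h1 : ∀ f : ℕ → ℤ × ℤ, #((range (k + 1)).image f) ≤ k + 1 := fun f =>
        card_image_le.trans (card_range _).le
      refine (card_union_le _ _).trans ?_
      refine (Nat.add_le_add (card_union_le _ _) (card_union_le _ _)).trans ?_
      have h2 := h1 (fun i : ℕ => ((i : ℤ), (k : ℤ) + 1 - i))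
      have h3 := h1 (fun i : ℕ => ((k : ℤ) + 1 - i, -(i : ℤ)))
      have h4 := h1 (fun i : ℕ => (-(i : ℤ), -((k : ℤ) + 1 - i)))
      have h5 := h1 (fun i : ℕ => (-((k : ℤ) + 1 - i), (i : ℤ)))
      omega
    refine ⟨B ∪ C.image g, ?_, fun a b hab => ?_⟩
    · have := card_union_le B (C.image g)
      have h2 : #(C.image g) ≤ #C := card_image_le
      nlinarith
    · rw [mem_union]
      rcases hab.lt_or_eq with hlt | heq
      · exact Or.inl (h a b (by omega))
      · refine Or.inr (mem_image.2 ⟨(a, b), ?_, rfl⟩)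
        simp only [C, mem_union, mem_image, mem_range, Prod.mk.injEq]
        rcases le_or_gt 0 a with ha | ha <;> rcases le_or_gt 0 b with hb | hb
        · rcases hb.lt_or_eq with hb' | hb'
          · exact Or.inl (Or.inl ⟨a.toNat, by omega, by omega, by omega⟩)
          · exact Or.inl (Or.inr ⟨0, by omega, by push_cast; omega, by push_cast; omega⟩)
        · rcases ha.lt_or_eq with ha' | ha'
          · exact Or.inl (Or.inr ⟨(-b).toNat, by omega, by omega, by omega⟩)
          · exact Or.inr (Or.inl ⟨0, by omega, by push_cast; omega, by push_cast; omega⟩)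
        · exact Or.inr (Or.inr ⟨b.toNat, by omega, by omega, by omega⟩)
        · exact Or.inr (Or.inl ⟨(-a).toNat, by omega, by omega, by omega⟩)

theorem exists_displacement {x y : ZMod n} (p : (circulant n s).Walk x y) :
    ∃ a b : ℤ, a.natAbs + b.natAbs ≤ p.length ∧ y - x = (a : ZMod n) + b * s := by
  induction p with
  | nil => exact ⟨0, 0, by simp, by simp⟩
  | @cons u v w h p ih =>
    obtain ⟨a, b, hab, e⟩ := ih
    have hc := circulant_adj_sub h
    simp only [Finset.mem_insert, Finset.mem_singleton] at hc
    have e' : w - u = (w - v) + (v - u) := by ring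
    rw [SimpleGraph.Walk.length_cons]
    rcases hc with hc | hc | hc | hc
    · exact ⟨a + 1, b, by omega, by rw [e', e, hc]; push_cast; ring⟩
    · exact ⟨a - 1, b, by omega, by rw [e', e, hc]; push_cast; ring⟩
    · exact ⟨a, b + 1, by omega, by rw [e', e, hc]; push_cast; ring⟩
    · exact ⟨a, b - 1, by omega, by rw [e', e, hc]; push_cast; ring⟩

/-- Layer-cake summation: `∑ l y` is at least the sum over `k < K` of the number of `y` with `l y >
k`, and all `y` outside the ball of radius `k` are such. The ball sizes stand on the right to avoid
truncated subtraction. -/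
theorem le_sum_of_displacement [NeZero n] (x : ZMod n) (l : ZMod n → ℕ)
    (hl : ∀ y, ∃ a b : ℤ, a.natAbs + b.natAbs ≤ l y ∧ y - x = (a : ZMod n) + b * s) (K : ℕ) :
    n * K ≤ ∑ y, l y + ∑ k ∈ range K, (2 * k ^ 2 + 2 * k + 1) := by
  classical
  have hball : ∀ k, #(univ.filter fun y => l y ≤ k) ≤ 2 * k ^ 2 + 2 * k + 1 := by
    intro k
    obtain ⟨B, hB, h⟩ := card_l1_ball_le n s k
    refine le_trans (card_le_card_of_injOn (fun y => y - x) ?_ sub_left_injective.injOn) hB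
    intro y hy
    obtain ⟨a, b, hab, e⟩ := hl y
    have hy' : l y ≤ k := by simpa using hy
    simp only [e]
    exact h a b (hab.trans hy')
  have hlayer : ∀ y, ∑ k ∈ range K, (if k < l y then 1 else 0) ≤ l y := by
    intro y
    rw [sum_boole]
    have : (range K).filter (fun k => k < l y) ⊆ range (l y) := fun k hk => by
      simp only [mem_filter] at hk
      simpa using hk.2
    simpa using card_le_card this
  have hsum : ∑ k ∈ range K, #(univ.filter fun y => k < l y) ≤ ∑ y, l y := by
    refine le_trans (le_of_eq ?_) (sum_le_sum fun y _ => hlayer y)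
    rw [sum_comm]
    refine sum_congr rfl fun k _ => ?_
    rw [sum_boole]
    simp
  have htot : ∀ k, n ≤ #(univ.filter fun y => k < l y) + (2 * k ^ 2 + 2 * k + 1) := by
    intro k
    have h := card_filter_add_card_filter_not (s := (univ : Finset (ZMod n))) (fun y => k < l y)
    simp only [not_lt, card_univ, ZMod.card] at h
    have := hball k
    omega
  calc n * K = ∑ k ∈ range K, n := by simp [mul_comm]
    _ ≤ ∑ k ∈ range K, (#(univ.filter fun y => k < l y) + (2 * k ^ 2 + 2 * k + 1)) :=
        sum_le_sum fun k _ => htot k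
    _ ≤ _ := by rw [sum_add_distrib]; omega

theorem card_dart_le [NeZero n] [Fintype (circulant n s).Dart] :
    Fintype.card (circulant n s).Dart ≤ 4 * n := by
  classical
  let C : Finset (ZMod n) := {1, -1, (s : ZMod n), -(s : ZMod n)}
  have hC : #C ≤ 4 := card_le_four
  have : #(univ : Finset (circulant n s).Dart) ≤ #(C ×ˢ (univ : Finset (ZMod n))) := by
    refine card_le_card_of_injOn (fun a => (a.snd - a.fst, a.fst)) ?_ ?_
    · intro a _
      simpa [C] using circulant_adj_sub a.adj
    · intro a _ b _ h
      simp only [Prod.mk.injEq] at h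
      obtain ⟨h1, h2⟩ := h
      rw [h2] at h1
      exact SimpleGraph.Dart.ext _ _ (Prod.ext h2 (sub_left_injective h1))
  rw [card_product, card_univ, card_univ, ZMod.card] at this
  exact this.trans (Nat.mul_le_mul_right _ hC)

/-- Lower bounds for the loads of an arbitrary routing, from the number of vertices that are close
to a given one. -/
theorem Routing.ball_bounds [NeZero n] (R : Routing (circulant n s)) (K : ℕ) :
    n * K ≤ 4 * R.maxArcLoad + ∑ k ∈ range K, (2 * k ^ 2 + 2 * k + 1) ∧
    n * K ≤ 2 * R.maxEdgeLoad + ∑ k ∈ range K, (2 * k ^ 2 + 2 * k + 1) := by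
  classical
  have := finite_dart (circulant n s)
  have := Fintype.ofFinite (circulant n s).Dart
  have hpos : 0 < n := Nat.pos_of_ne_zero (NeZero.ne n)
  set Q := ∑ k ∈ range K, (2 * k ^ 2 + 2 * k + 1)
  have h1 : ∀ x : ZMod n, n * K ≤ ∑ y, R.uses univ x y + Q := by
    intro x
    refine le_sum_of_displacement (s := s) x _ (fun y => ?_) K
    by_cases h : x = y
    · subst h
      exact ⟨0, 0, by simp, by simp⟩
    · rw [R.uses_univ h]
      exact exists_displacement _
  have h2 : n * (n * K) ≤ ∑ a, R.arcLoad a + n * Q := by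
    rw [R.sum_arcLoad_eq]
    have := sum_le_sum fun (x : ZMod n) (_ : x ∈ univ) => h1 x
    simpa [sum_add_distrib, ZMod.card] using this
  have h3 := R.sum_arcLoad_le univ
  have h4 := R.sum_arcLoad_symm_le univ
  -- Reversal permutes the arcs, so edge loads summed over arcs count the total length twice. This
  -- is why `2` replaces `4` in the edge bound.
  have h5 : ∑ a : (circulant n s).Dart, R.arcLoad a.symm = ∑ a, R.arcLoad a :=
    (Equiv.sum_comp (SimpleGraph.Dart.symm_involutive.toPerm _) R.arcLoad)
  have h6 : #(univ : Finset (circulant n s).Dart) ≤ 4 * n := card_dart_le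
  rw [h5] at h4
  have h7 := Nat.mul_le_mul_right R.maxArcLoad h6
  have h8 := Nat.mul_le_mul_right R.maxEdgeLoad h6
  constructor
  · refine Nat.le_of_mul_le_mul_left ?_ hpos
    nlinarith
  · refine Nat.le_of_mul_le_mul_left ?_ hpos
    nlinarith

end Circulant

/-! ### The path from `0` to `d` as a function of the position along it. -/

/-- The number of steps `s` on the path from `0` to `d`. -/
def longSteps (s d : ℕ) : ℕ := if d % s ≤ s / 2 then d / s else d / s + 1

/-- The number of steps `±1` on the path from `0` to `d`. -/
def unitSteps (s d : ℕ) : ℕ := if d % s ≤ s / 2 then d % s else s - d % s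

/-- The `k`-th vertex of the path from `0` to `d`. -/
def forwardVertex (s d k : ℕ) : ℕ :=
  if k ≤ longSteps s d then k * s
  else if d % s ≤ s / 2 then longSteps s d * s + (k - longSteps s d)
  else longSteps s d * s - (k - longSteps s d)

theorem forwardPath_eq (s d : ℕ) :
    forwardPath s d =
      (List.range (longSteps s d + unitSteps s d + 1)).map (forwardVertex s d) := by
  have e : longSteps s d + unitSteps s d + 1 = (longSteps s d + 1) + unitSteps s d := by ring
  rw [e, List.range_add, List.map_append, List.map_map]
  unfold forwardPath
  have h1 : (List.range (longSteps s d + 1)).map (forwardVertex s d) =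
      (List.range (longSteps s d + 1)).map (fun k => k * s) := by
    refine List.map_congr_left fun k hk => ?_
    rw [List.mem_range] at hk
    rw [forwardVertex, if_pos (by omega)]
  rw [h1]
  by_cases h : d % s ≤ s / 2
  · have hl : longSteps s d = d / s := if_pos h
    have hu : unitSteps s d = d % s := if_pos h
    simp only [if_pos h, hl, hu]
    congr 1
    refine List.map_congr_left fun k _ => ?_
    simp only [Function.comp, forwardVertex, hl, if_pos h]
    rw [if_neg (by omega)]
    omega
  · have hl : longSteps s d = d / s + 1 := if_neg h
    have hu : unitSteps s d = s - d % s := if_neg h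
    simp only [if_neg h, hl, hu]
    congr 1
    refine List.map_congr_left fun k _ => ?_
    simp only [Function.comp, forwardVertex, hl, if_neg h]
    rw [if_neg (by omega)]
    congr 1
    omega

theorem longSteps_mul {s d : ℕ} (h : d % s ≤ s / 2) : longSteps s d * s + unitSteps s d = d := by
  rw [longSteps, unitSteps, if_pos h, if_pos h, mul_comm]
  exact Nat.div_add_mod d s

theorem longSteps_mul_of_lt {s d : ℕ} (hs : 0 < s) (h : ¬ d % s ≤ s / 2) :
    longSteps s d * s = d + unitSteps s d := by
  rw [longSteps, unitSteps, if_neg h, if_neg h]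
  have h1 := Nat.div_add_mod d s
  have h2 := Nat.mod_lt d hs
  have h3 : (d / s + 1) * s = s * (d / s) + s := by ring
  omega

theorem unitSteps_le (s d : ℕ) : unitSteps s d ≤ s / 2 := by
  unfold unitSteps
  split_ifs <;> omega

/-- Ensures that the truncated subtraction in the backward branch of `forwardVertex` is a true one.
-/
theorem unitSteps_le_longSteps_mul {s d : ℕ} (h : ¬ d % s ≤ s / 2) :
    unitSteps s d + s / 2 ≤ longSteps s d * s := by
  rw [longSteps, unitSteps, if_neg h, if_neg h, add_mul]
  omega

theorem forwardVertex_zero (s d : ℕ) : forwardVertex s d 0 = 0 := by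
  simp [forwardVertex]

theorem forwardVertex_last {s : ℕ} (hs : 0 < s) (d : ℕ) :
    forwardVertex s d (longSteps s d + unitSteps s d) = d := by
  unfold forwardVertex
  by_cases h : d % s ≤ s / 2
  · have := longSteps_mul h
    rw [if_pos h]
    split_ifs with h1
    · have h2 : unitSteps s d = 0 := by omega
      rw [h2] at this ⊢
      simpa using this
    · omega
  · have := longSteps_mul_of_lt hs h
    have h3 : 0 < unitSteps s d := by
      have := Nat.mod_lt d hs
      rw [unitSteps, if_neg h]
      omega
    rw [if_neg h, if_neg (by omega)]
    omega

theorem forwardVertex_succ_of_lt {s d k : ℕ} (h : k < longSteps s d) :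
    forwardVertex s d (k + 1) = forwardVertex s d k + s := by
  rw [forwardVertex, forwardVertex, if_pos (by omega), if_pos (by omega)]
  ring

theorem forwardVertex_of_le {s d k : ℕ} (h : d % s ≤ s / 2) (hk : longSteps s d ≤ k) :
    forwardVertex s d k = longSteps s d * s + (k - longSteps s d) := by
  rw [forwardVertex, if_pos h]
  split_ifs with h1
  · obtain rfl : k = longSteps s d := by omega
    simp
  · rfl

theorem forwardVertex_of_le' {s d k : ℕ} (h : ¬ d % s ≤ s / 2) (hk : longSteps s d ≤ k) :
    forwardVertex s d k = longSteps s d * s - (k - longSteps s d) := by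
  rw [forwardVertex, if_neg h]
  split_ifs with h1
  · obtain rfl : k = longSteps s d := by omega
    simp
  · rfl

theorem forwardVertex_le {s d k : ℕ} (hs : 0 < s) (hk : k ≤ longSteps s d + unitSteps s d) :
    forwardVertex s d k ≤ d + s / 2 := by
  have hu := unitSteps_le s d
  have h3 : longSteps s d * s ≤ d + s / 2 := by
    by_cases h : d % s ≤ s / 2
    · have := longSteps_mul h
      omega
    · have := longSteps_mul_of_lt hs h
      omega
  rcases le_total k (longSteps s d) with h1 | h1
  · rw [forwardVertex, if_pos h1]
    exact (Nat.mul_le_mul_right s h1).trans h3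
  · by_cases h : d % s ≤ s / 2
    · have := longSteps_mul h
      rw [forwardVertex_of_le h h1]
      omega
    · rw [forwardVertex_of_le' h h1]
      omega

/-- The only danger is a path that overshoots `d` and returns. It goes back by fewer than `s / 2`
units, so it does not reach the previous multiple of `s`. -/
theorem forwardVertex_injOn {s d k l : ℕ} (hs : 0 < s)
    (hl : l ≤ longSteps s d + unitSteps s d) (hkl : k < l) :
    forwardVertex s d k ≠ forwardVertex s d l := by
  rcases le_total l (longSteps s d) with h1 | h1
  · rw [forwardVertex, forwardVertex, if_pos (by omega), if_pos h1]
    exact (Nat.mul_lt_mul_of_pos_right hkl hs).ne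
  · rcases le_total k (longSteps s d) with h2 | h2
    · have h4 : forwardVertex s d k = k * s := by rw [forwardVertex, if_pos h2]
      have hmul := Nat.mul_le_mul_right s h2
      rw [h4]
      by_cases h : d % s ≤ s / 2
      · rw [forwardVertex_of_le h h1]
        rcases h2.lt_or_eq with h3 | h3
        · have := Nat.mul_lt_mul_of_pos_right h3 hs
          omega
        · rw [h3]; omega
      · rw [forwardVertex_of_le' h h1]
        have h5 := unitSteps_le_longSteps_mul h
        have h6 : 2 * unitSteps s d < s := by
          rw [unitSteps, if_neg h]; omega
        rcases h2.lt_or_eq with h3 | h3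
        · have h7 : (k + 1) * s ≤ longSteps s d * s := Nat.mul_le_mul_right s h3
          rw [add_mul] at h7
          omega
        · rw [h3]; omega
    · by_cases h : d % s ≤ s / 2
      · rw [forwardVertex_of_le h h1, forwardVertex_of_le h h2]
        omega
      · rw [forwardVertex_of_le' h h1, forwardVertex_of_le' h h2]
        have h5 := unitSteps_le_longSteps_mul h
        omega

/-! ### The routing on `ZMod n`, and the steps that its paths take. -/

section Route

variable {n s : ℕ}

/-- The length of the shorter of the two arcs of the cycle between `0` and `d`. -/
def cycleNorm (n d : ℕ) : ℕ := if d ≤ n / 2 then d else n - d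

/-- The direction in which the path from `0` to `d` leaves `0`. -/
def cycleSign (n d : ℕ) : ZMod n := if d ≤ n / 2 then 1 else -1

/-- The number of edges of the path from `0` to `d`. -/
def routeLength (n s d : ℕ) : ℕ := longSteps s (cycleNorm n d) + unitSteps s (cycleNorm n d)

/-- The `k`-th vertex of the path from `x` to `x + d`. -/
def routeVertex (n s : ℕ) (x : ZMod n) (d k : ℕ) : ZMod n :=
  x + cycleSign n d * (forwardVertex s (cycleNorm n d) k : ZMod n)

/-- The step after the `k`-th vertex of the path from `x` to `x + d`. -/
def routeStep (n s d k : ℕ) : ZMod n :=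
  cycleSign n d * if k < longSteps s (cycleNorm n d) then (s : ZMod n)
    else if cycleNorm n d % s ≤ s / 2 then 1 else -1

/-- The casts of lists in `pathFromZero` and `Routing.encode` elaborate to this monadic form. -/
theorem natCast_list_eq_map (l : List ℕ) :
    (do let a ← l; pure (a : ZMod n)) = l.map (fun v : ℕ => (v : ZMod n)) := by
  induction l with
  | nil => rfl
  | cons a l ih => simp_all

theorem routePath_eq (x y : ZMod n) :
    routePath n s x y =
      (List.range (routeLength n s (y - x).val + 1)).map (routeVertex n s x (y - x).val) := by
  unfold routePath pathFromZero routeLength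
  rw [natCast_list_eq_map, natCast_list_eq_map]
  split_ifs with h
  · rw [forwardPath_eq, List.map_map, List.map_map, List.map_map]
    rw [cycleNorm, if_pos h]
    refine List.map_congr_left fun k _ => ?_
    simp [routeVertex, cycleNorm, cycleSign, h]
  · rw [forwardPath_eq, List.map_map, List.map_map, List.map_map]
    rw [cycleNorm, if_neg h]
    refine List.map_congr_left fun k _ => ?_
    simp [routeVertex, cycleNorm, cycleSign, h]

theorem routeVertex_zero (x : ZMod n) (d : ℕ) : routeVertex n s x d 0 = x := by
  simp [routeVertex, forwardVertex_zero]

theorem routeVertex_last (hs : 0 < s) (x : ZMod n) {d : ℕ} (hd : d ≤ n) :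
    routeVertex n s x d (routeLength n s d) = x + d := by
  rw [routeVertex, routeLength, forwardVertex_last hs, cycleSign, cycleNorm]
  split_ifs
  · ring
  · rw [Nat.cast_sub hd]
    simp

theorem routeVertex_succ (hs : 0 < s) (x : ZMod n) {d k : ℕ} (hk : k < routeLength n s d) :
    routeVertex n s x d (k + 1) = routeVertex n s x d k + routeStep n s d k := by
  unfold routeVertex routeStep
  unfold routeLength at hk
  rw [add_assoc, ← mul_add]
  congr 2
  by_cases h1 : k < longSteps s (cycleNorm n d)
  · rw [if_pos h1, forwardVertex_succ_of_lt h1]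
    push_cast
    rfl
  · rw [if_neg h1]
    by_cases h : cycleNorm n d % s ≤ s / 2
    · rw [if_pos h, forwardVertex_of_le h (by omega), forwardVertex_of_le h (by omega)]
      rw [show k + 1 - longSteps s (cycleNorm n d) = k - longSteps s (cycleNorm n d) + 1 by omega]
      push_cast
      ring
    · rw [if_neg h, forwardVertex_of_le' h (by omega), forwardVertex_of_le' h (by omega)]
      have := unitSteps_le_longSteps_mul h
      rw [show longSteps s (cycleNorm n d) * s - (k - longSteps s (cycleNorm n d)) =
        longSteps s (cycleNorm n d) * s - (k + 1 - longSteps s (cycleNorm n d)) + 1 by omega]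
      push_cast
      ring

theorem cycleNorm_le {d : ℕ} : cycleNorm n d ≤ n / 2 := by
  unfold cycleNorm
  split_ifs <;> omega

/-- Before reduction the vertices are at most `n / 2 + s / 2 < n`, so reduction modulo `n`
identifies none of them. -/
theorem routeVertex_injOn (hs : 0 < s) (hn : 2 * s < n) (x : ZMod n) {d k l : ℕ}
    (hl : l ≤ routeLength n s d) (hkl : k < l) :
    routeVertex n s x d k ≠ routeVertex n s x d l := by
  intro h
  have hc : cycleNorm n d ≤ n / 2 := cycleNorm_le
  unfold routeVertex at h
  unfold routeLength at hl
  have h2 : (forwardVertex s (cycleNorm n d) k : ZMod n) = forwardVertex s (cycleNorm n d) l := by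
    have := add_left_cancel h
    unfold cycleSign at this
    split_ifs at this
    · simpa using this
    · simpa using this
  have hk' := forwardVertex_le hs (show k ≤ _ by omega : k ≤ longSteps s (cycleNorm n d) + _)
  have hl' := forwardVertex_le hs hl
  refine forwardVertex_injOn hs hl hkl ?_
  rw [ZMod.natCast_eq_natCast_iff'] at h2
  rwa [Nat.mod_eq_of_lt (by omega), Nat.mod_eq_of_lt (by omega)] at h2

theorem natCast_ne_zero_of_lt {m : ℕ} (h0 : 0 < m) (hm : m < n) : (m : ZMod n) ≠ 0 := by
  rw [Ne, ZMod.natCast_eq_zero_iff]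
  exact Nat.not_dvd_of_pos_of_lt h0 hm

theorem routeStep_mem (d k : ℕ) :
    routeStep n s d k ∈ ({1, -1, (s : ZMod n), -(s : ZMod n)} : Set (ZMod n)) := by
  unfold routeStep cycleSign
  simp only [Set.mem_insert_iff, Set.mem_singleton_iff]
  split_ifs <;> simp

theorem exists_routing [NeZero n] (hs : 0 < s) (hn : 2 * s < n) :
    ∃ R : Routing (circulant n s), ∀ (x y : ZMod n) (h : x ≠ y),
      (R x y h).1.support = routePath n s x y ∧
      ∀ a ∈ (R x y h).1.darts, ∃ k < routeLength n s (y - x).val,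
        a.fst = routeVertex n s x (y - x).val k ∧
        a.snd = routeVertex n s x (y - x).val (k + 1) := by
  suffices H : ∀ (x y : ZMod n), x ≠ y → ∃ p : (circulant n s).Path x y,
      p.1.support = routePath n s x y ∧
      ∀ a ∈ p.1.darts, ∃ k < routeLength n s (y - x).val,
        a.fst = routeVertex n s x (y - x).val k ∧
        a.snd = routeVertex n s x (y - x).val (k + 1) by
    choose R hR using H
    exact ⟨R, hR⟩
  intro x y _
  set d := (y - x).val with hd
  have hdn : d ≤ n := (ZMod.val_lt _).le
  obtain ⟨p, hp, hda⟩ := exists_walk_of_adj (G := circulant n s) (routeVertex n s x d)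
    (routeLength n s d) fun k hk => by
      have hne := routeVertex_injOn hs hn x (d := d) hk k.lt_succ_self
      rw [circulant, SimpleGraph.circulantGraph_adj]
      refine ⟨hne, Or.inr ?_⟩
      rw [routeVertex_succ hs x hk, add_sub_cancel_left]
      exact routeStep_mem d k
  have h0 := routeVertex_zero (s := s) x d
  have h1 : routeVertex n s x d (routeLength n s d) = y := by
    rw [routeVertex_last hs x hdn, hd, ZMod.natCast_zmod_val]
    ring
  have hp' : p.support = routePath n s x y := by rw [hp, routePath_eq]
  have hnd : p.support.Nodup := by
    rw [hp]
    refine List.Nodup.map_on ?_ List.nodup_range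
    intro k hk l hl hkl
    rw [List.mem_range] at hk hl
    rcases lt_trichotomy k l with h | h | h
    · exact absurd hkl (routeVertex_injOn hs hn x (by omega) h)
    · exact h
    · exact absurd hkl.symm (routeVertex_injOn hs hn x (by omega) h)
  refine ⟨⟨p.copy h0 h1, ?_⟩, ?_, ?_⟩
  · rw [SimpleGraph.Walk.isPath_def, SimpleGraph.Walk.support_copy]
    exact hnd
  · rw [SimpleGraph.Walk.support_copy, hp']
  · intro a ha
    rw [SimpleGraph.Walk.darts_copy] at ha
    exact hda a ha

/-- A routing each of whose arcs lies on the paths of `routePath`. -/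
def FollowsRoute [NeZero n] (R : Routing (circulant n s)) : Prop :=
  ∀ (x y : ZMod n) (h : x ≠ y), ∀ a ∈ (R x y h).1.darts, ∃ k < routeLength n s (y - x).val,
    a.fst = routeVertex n s x (y - x).val k ∧ a.snd = routeVertex n s x (y - x).val (k + 1)

/-- By translation invariance, the difference `d` and the position `k` of the arc `a` on a path
determine the start of the path, hence the path. -/
theorem FollowsRoute.arcLoad_le [NeZero n] (hs : 0 < s) {R : Routing (circulant n s)}
    (hR : FollowsRoute R) (a : (circulant n s).Dart) :
    R.arcLoad a ≤ ∑ d ∈ Ico 1 n,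
      #((range (routeLength n s d)).filter fun k => routeStep n s d k = a.snd - a.fst) := by
  classical
  let T : Finset (Σ _ : ℕ, ℕ) := (Ico 1 n).sigma fun d =>
    (range (routeLength n s d)).filter fun k => routeStep n s d k = a.snd - a.fst
  let g : (Σ _ : ℕ, ℕ) → ZMod n × ZMod n := fun q =>
    (a.fst - routeVertex n s 0 q.1 q.2, a.fst - routeVertex n s 0 q.1 q.2 + q.1)
  have h : {p : ZMod n × ZMod n | ∃ h : p.1 ≠ p.2, a ∈ (R p.1 p.2 h).1.darts} ⊆
      ((T.image g : Finset (ZMod n × ZMod n)) : Set (ZMod n × ZMod n)) := by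
    rintro ⟨x, y⟩ ⟨hxy, ha⟩
    obtain ⟨k, hk, h1, h2⟩ := hR x y hxy a ha
    simp only at hxy hk h1 h2
    have hd0 : (y - x).val ≠ 0 := by
      rw [Ne, ZMod.val_eq_zero, sub_eq_zero]
      exact fun h => hxy h.symm
    have hx : a.fst - routeVertex n s 0 (y - x).val k = x := by
      rw [h1]
      simp [routeVertex]
    rw [coe_image, Set.mem_image]
    refine ⟨⟨(y - x).val, k⟩, ?_, ?_⟩
    · simp only [T, mem_coe, mem_sigma, mem_Ico, mem_filter, mem_range]
      refine ⟨⟨by omega, ZMod.val_lt _⟩, hk, ?_⟩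
      rw [h2, h1, routeVertex_succ hs x hk]
      ring
    · simp only [g, hx, ZMod.natCast_zmod_val]
      ring_nf
  calc R.arcLoad a ≤ Set.ncard ((T.image g : Finset (ZMod n × ZMod n)) : Set (ZMod n × ZMod n)) :=
        Set.ncard_le_ncard h (Set.toFinite _)
    _ = #(T.image g) := Set.ncard_coe_finset _
    _ ≤ #T := card_image_le
    _ = _ := card_sigma _ _

/-- The upper limits differ for even `n`: the difference `n / 2` is routed in the positive direction
only. -/
theorem sum_fold (f g : ℕ → ℕ) (n : ℕ) :
    ∑ d ∈ Ico 1 n, (if d ≤ n / 2 then f d else g (n - d)) ≤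
      ∑ d ∈ Icc 1 (n / 2), f d + ∑ d ∈ Icc 1 ((n - 1) / 2), g d := by
  rw [sum_ite]
  refine Nat.add_le_add (sum_le_sum_of_subset ?_) ?_
  · intro d
    simp only [mem_filter, mem_Ico, mem_Icc]
    omega
  · refine le_of_eq (sum_bij (fun d _ => n - d) ?_ ?_ ?_ fun _ _ => rfl)
    · intro d
      simp only [mem_filter, mem_Ico, mem_Icc]
      omega
    · intro a ha b hb
      simp only [mem_filter, mem_Ico] at ha hb
      omega
    · intro b hb
      simp only [mem_Icc] at hb
      refine ⟨n - b, ?_, by omega⟩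
      simp only [mem_filter, mem_Ico]
      omega

/-- Since `2 ≤ s` and `2 * s < n`, the residues `1`, `-1`, `s`, `-s` are distinct, so the residue of
a step reveals its kind and direction. -/
theorem card_filter_routeStep_le (hs : 2 ≤ s) (hn : 2 * s < n) (d : ℕ) :
    #((range (routeLength n s d)).filter fun k => routeStep n s d k = s) ≤
        (if d ≤ n / 2 then longSteps s d else 0) ∧
    #((range (routeLength n s d)).filter fun k => routeStep n s d k = -s) ≤
        (if d ≤ n / 2 then 0 else longSteps s (n - d)) ∧
    #((range (routeLength n s d)).filter fun k => routeStep n s d k = 1) ≤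
        (if d ≤ n / 2 then (if d % s ≤ s / 2 then unitSteps s d else 0)
          else (if (n - d) % s ≤ s / 2 then 0 else unitSteps s (n - d))) ∧
    #((range (routeLength n s d)).filter fun k => routeStep n s d k = -1) ≤
        (if d ≤ n / 2 then (if d % s ≤ s / 2 then 0 else unitSteps s d)
          else (if (n - d) % s ≤ s / 2 then unitSteps s (n - d) else 0)) := by
  have d1 : (1 : ZMod n) ≠ -1 := by
    intro h
    refine natCast_ne_zero_of_lt (n := n) (m := 2) (by omega) (by omega) ?_
    push_cast
    linear_combination h
  have d2 : (s : ZMod n) ≠ -s := by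
    intro h
    refine natCast_ne_zero_of_lt (n := n) (m := 2 * s) (by omega) (by omega) ?_
    push_cast
    linear_combination h
  have d3 : (s : ZMod n) ≠ 1 := by
    intro h
    refine natCast_ne_zero_of_lt (n := n) (m := s - 1) (by omega) (by omega) ?_
    rw [Nat.cast_sub (by omega)]
    push_cast
    linear_combination h
  have d4 : (s : ZMod n) ≠ -1 := by
    intro h
    refine natCast_ne_zero_of_lt (n := n) (m := s + 1) (by omega) (by omega) ?_
    push_cast
    linear_combination h
  have d5 : -(s : ZMod n) ≠ 1 := fun h => d4 (by rw [← h, neg_neg])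
  have d6 : -(s : ZMod n) ≠ -1 := fun h => d3 (neg_injective h)
  have key : ∀ (c : ZMod n) (A : Finset ℕ) (m : ℕ), #A ≤ m →
      (∀ k < routeLength n s d, routeStep n s d k = c → k ∈ A) →
      #((range (routeLength n s d)).filter fun k => routeStep n s d k = c) ≤ m := by
    intro c A m hA h
    refine (card_le_card fun k hk => ?_).trans hA
    rw [mem_filter, mem_range] at hk
    exact h k hk.1 hk.2
  have hlong : #(range (longSteps s (cycleNorm n d))) = longSteps s (cycleNorm n d) := card_range _
  have hunit : #(Ico (longSteps s (cycleNorm n d)) (routeLength n s d)) =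
      unitSteps s (cycleNorm n d) := by
    rw [Nat.card_Ico, routeLength]
    omega
  have h0 : #(∅ : Finset ℕ) ≤ 0 := le_rfl
  have hneg : ∀ c : ZMod n, -(s : ZMod n) = c ↔ (s : ZMod n) = -c := fun c => neg_eq_iff_eq_neg
  unfold cycleNorm at hlong hunit
  refine ⟨?_, ?_, ?_, ?_⟩
  · by_cases hd : d ≤ n / 2
    · simp only [hd, if_true] at hlong ⊢
      refine key _ _ _ hlong.le fun k hk h => ?_
      by_contra hlt
      simp only [mem_range] at hlt
      simp only [routeStep, cycleSign, cycleNorm, hd, if_true, if_neg hlt] at h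
      split_ifs at h <;> simp_all
    · simp only [hd, if_false] at hlong ⊢
      refine key _ _ _ h0 fun k hk h => ?_
      simp only [routeStep, cycleSign, cycleNorm, hd, if_false] at h
      split_ifs at h <;> simp_all
  · by_cases hd : d ≤ n / 2
    · simp only [hd, if_true] at hlong ⊢
      refine key _ _ _ h0 fun k hk h => ?_
      simp only [routeStep, cycleSign, cycleNorm, hd, if_true] at h
      split_ifs at h <;> simp_all
    · simp only [hd, if_false] at hlong ⊢
      refine key _ _ _ hlong.le fun k hk h => ?_
      by_contra hlt
      simp only [mem_range] at hlt
      simp only [routeStep, cycleSign, cycleNorm, hd, if_false, if_neg hlt] at h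
      split_ifs at h <;> simp_all
  · by_cases hd : d ≤ n / 2
    · simp only [hd, if_true] at hunit ⊢
      by_cases hu : d % s ≤ s / 2
      · simp only [hu, if_true]
        refine key _ _ _ hunit.le fun k hk h => ?_
        by_contra hlt
        have hlt' : k < longSteps s d := by
          by_contra h'
          exact hlt (mem_Ico.2 ⟨by omega, hk⟩)
        simp only [routeStep, cycleSign, cycleNorm, hd, if_true, if_pos hlt'] at h
        simp_all
      · simp only [hu, if_false]
        refine key _ _ _ h0 fun k hk h => ?_
        simp only [routeStep, cycleSign, cycleNorm, hd, hu, if_true, if_false] at h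
        split_ifs at h <;> simp_all
    · simp only [hd, if_false] at hunit ⊢
      by_cases hu : (n - d) % s ≤ s / 2
      · simp only [hu, if_true]
        refine key _ _ _ h0 fun k hk h => ?_
        simp only [routeStep, cycleSign, cycleNorm, hd, hu, if_false, if_true] at h
        split_ifs at h <;> simp_all
      · simp only [hu, if_false]
        refine key _ _ _ hunit.le fun k hk h => ?_
        by_contra hlt
        have hlt' : k < longSteps s (n - d) := by
          by_contra h'
          exact hlt (mem_Ico.2 ⟨by omega, hk⟩)
        simp only [routeStep, cycleSign, cycleNorm, hd, if_false, if_pos hlt'] at h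
        simp_all
  · by_cases hd : d ≤ n / 2
    · simp only [hd, if_true] at hunit ⊢
      by_cases hu : d % s ≤ s / 2
      · simp only [hu, if_true]
        refine key _ _ _ h0 fun k hk h => ?_
        simp only [routeStep, cycleSign, cycleNorm, hd, hu, if_true, if_true] at h
        split_ifs at h <;> simp_all
      · simp only [hu, if_false]
        refine key _ _ _ hunit.le fun k hk h => ?_
        by_contra hlt
        have hlt' : k < longSteps s d := by
          by_contra h'
          exact hlt (mem_Ico.2 ⟨by omega, hk⟩)
        simp only [routeStep, cycleSign, cycleNorm, hd, if_true, if_pos hlt'] at h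
        simp_all
    · simp only [hd, if_false] at hunit ⊢
      by_cases hu : (n - d) % s ≤ s / 2
      · simp only [hu, if_true]
        refine key _ _ _ hunit.le fun k hk h => ?_
        by_contra hlt
        have hlt' : k < longSteps s (n - d) := by
          by_contra h'
          exact hlt (mem_Ico.2 ⟨by omega, hk⟩)
        simp only [routeStep, cycleSign, cycleNorm, hd, if_false, if_pos hlt'] at h
        simp_all
      · simp only [hu, if_false]
        refine key _ _ _ h0 fun k hk h => ?_
        simp only [routeStep, cycleSign, cycleNorm, hd, hu, if_false, if_false] at h
        split_ifs at h <;> simp_all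

end Route

/-! ### Upper bounds for the loads of the constructed routing. -/

section Loads

variable {n s : ℕ}

/-- The load of an arc of step `s` is at most `∑ d ≤ ⌊n / 2⌋, longSteps s d`, and similarly for the
other steps. -/
theorem FollowsRoute.arcLoad_bounds [NeZero n] (hs : 2 ≤ s) (hn : 2 * s < n)
    {R : Routing (circulant n s)} (hR : FollowsRoute R) (a : (circulant n s).Dart) :
    (a.snd - a.fst = s → R.arcLoad a ≤ ∑ d ∈ Icc 1 (n / 2), longSteps s d) ∧
    (a.snd - a.fst = -s → R.arcLoad a ≤ ∑ d ∈ Icc 1 ((n - 1) / 2), longSteps s d) ∧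
    (a.snd - a.fst = 1 → R.arcLoad a ≤ ∑ d ∈ Icc 1 (n / 2), unitSteps s d) ∧
    (a.snd - a.fst = -1 → R.arcLoad a ≤ ∑ d ∈ Icc 1 (n / 2), unitSteps s d) := by
  have h := hR.arcLoad_le (by omega) a
  have hc := card_filter_routeStep_le hs hn
  have hsub : Icc 1 ((n - 1) / 2) ⊆ Icc 1 (n / 2) := Icc_subset_Icc_right (by omega)
  refine ⟨fun e => ?_, fun e => ?_, fun e => ?_, fun e => ?_⟩
  all_goals rw [e] at h
  · have h2 := (sum_le_sum fun d _ => (hc d).1).trans (sum_fold (longSteps s) (fun _ => 0) n)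
    simpa using h.trans h2
  · have h2 := (sum_le_sum fun d _ => (hc d).2.1).trans (sum_fold (fun _ => 0) (longSteps s) n)
    simpa using h.trans h2
  · have h2 := (sum_le_sum fun d _ => (hc d).2.2.1).trans
      (sum_fold (fun d => if d % s ≤ s / 2 then unitSteps s d else 0)
        (fun d => if d % s ≤ s / 2 then 0 else unitSteps s d) n)
    refine (h.trans h2).trans ((Nat.add_le_add_left (sum_le_sum_of_subset hsub) _).trans ?_)
    -- For each `d`, only one of the path to `d` and its mirror image uses the step `1`, according
    -- to `d % s`. Thus one sum over `d ≤ n / 2` suffices.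
    rw [← sum_add_distrib]
    refine sum_le_sum fun d _ => ?_
    split_ifs <;> simp
  · have h2 := (sum_le_sum fun d _ => (hc d).2.2.2).trans
      (sum_fold (fun d => if d % s ≤ s / 2 then 0 else unitSteps s d)
        (fun d => if d % s ≤ s / 2 then unitSteps s d else 0) n)
    refine (h.trans h2).trans ((Nat.add_le_add_left (sum_le_sum_of_subset hsub) _).trans ?_)
    rw [← sum_add_distrib]
    refine sum_le_sum fun d _ => ?_
    split_ifs <;> simp

theorem FollowsRoute.maxArcLoad_le [NeZero n] (hs : 2 ≤ s) (hn : 2 * s < n)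
    {R : Routing (circulant n s)} (hR : FollowsRoute R) :
    R.maxArcLoad ≤ max (∑ d ∈ Icc 1 (n / 2), longSteps s d)
      (∑ d ∈ Icc 1 (n / 2), unitSteps s d) := by
  refine ciSup_le' fun a => ?_
  obtain ⟨h1, h2, h3, h4⟩ := hR.arcLoad_bounds hs hn a
  have hsub : Icc 1 ((n - 1) / 2) ⊆ Icc 1 (n / 2) := Icc_subset_Icc_right (by omega)
  have hle := sum_le_sum_of_subset (f := longSteps s) hsub
  have hc := circulant_adj_sub a.adj
  simp only [Finset.mem_insert, Finset.mem_singleton] at hc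
  rcases hc with hc | hc | hc | hc
  · exact (h3 hc).trans (le_max_right _ _)
  · exact (h4 hc).trans (le_max_right _ _)
  · exact (h1 hc).trans (le_max_left _ _)
  · exact ((h2 hc).trans hle).trans (le_max_left _ _)

theorem FollowsRoute.maxEdgeLoad_le [NeZero n] (hs : 2 ≤ s) (hn : 2 * s < n)
    {R : Routing (circulant n s)} (hR : FollowsRoute R) :
    R.maxEdgeLoad ≤ max (∑ d ∈ Icc 1 (n / 2), longSteps s d + ∑ d ∈ Icc 1 ((n - 1) / 2), longSteps s d)
      (2 * ∑ d ∈ Icc 1 (n / 2), unitSteps s d) := by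
  refine ciSup_le' fun e => ?_
  obtain ⟨e, he⟩ := e
  obtain ⟨a, rfl⟩ : ∃ a : (circulant n s).Dart, a.edge = e := by
    induction e with
    | _ x y => exact ⟨⟨(x, y), he⟩, rfl⟩
  have hsymm : a.symm.snd - a.symm.fst = -(a.snd - a.fst) := (neg_sub _ _).symm
  obtain ⟨h1, h2, h3, h4⟩ := hR.arcLoad_bounds hs hn a
  obtain ⟨k1, k2, k3, k4⟩ := hR.arcLoad_bounds hs hn a.symm
  rw [hsymm] at k1 k2 k3 k4
  rw [R.edgeLoad_eq a]
  have hc := circulant_adj_sub a.adj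
  simp only [Finset.mem_insert, Finset.mem_singleton] at hc
  rw [le_max_iff]
  rcases hc with hc | hc | hc | hc
  · have := h3 hc
    have := k4 (by rw [hc])
    omega
  · have := h4 hc
    have := k3 (by rw [hc, neg_neg])
    omega
  · have := h1 hc
    have := k2 (by rw [hc])
    omega
  · have := h2 hc
    have := k1 (by rw [hc, neg_neg])
    omega

end Loads

/-! ### Estimates for the sums of `longSteps` and `unitSteps`. -/

section Sums

theorem div_mod_succ {s : ℕ} (hs : 0 < s) (D : ℕ) :
    (D % s + 1 < s ∧ (D + 1) / s = D / s ∧ (D + 1) % s = D % s + 1) ∨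
    (D % s + 1 = s ∧ (D + 1) / s = D / s + 1 ∧ (D + 1) % s = 0) := by
  have h1 := Nat.div_add_mod D s
  have h2 := Nat.mod_lt D hs
  rcases Nat.lt_or_ge (D % s + 1) s with h | h
  · left
    have e : D + 1 = (D % s + 1) + s * (D / s) := by omega
    refine ⟨h, ?_, ?_⟩
    · conv_lhs => rw [e]
      rw [Nat.add_mul_div_left _ _ hs, Nat.div_eq_of_lt h, zero_add]
    · conv_lhs => rw [e]
      rw [Nat.add_mul_mod_self_left, Nat.mod_eq_of_lt h]
  · right
    have e : D + 1 = s * (D / s + 1) := by rw [mul_add]; omega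
    refine ⟨by omega, ?_, ?_⟩
    · conv_lhs => rw [e]
      rw [Nat.mul_div_cancel_left _ hs]
    · conv_lhs => rw [e]
      rw [Nat.mul_mod_right]

/-- `longSteps s d` is `d / s` rounded to a nearest integer, ties going down, so the rounding errors
over a period sum to at most zero. -/
theorem sum_longSteps_le {s : ℕ} (hs : 2 ≤ s) (D : ℕ) :
    2 * s * ∑ d ∈ Icc 1 D, longSteps s d ≤ D * (D + 1) := by
  -- A nonnegative, `s`-periodic reserve within a period, added to the left side to make the
  -- induction on `D` go through.
  let g : ℕ → ℤ := fun D => if D % s ≤ s / 2 then ((D % s : ℕ) : ℤ) * ((D % s : ℕ) + 1)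
    else ((s : ℤ) - 1 - (D % s : ℕ)) * (s - (D % s : ℕ))
  have hg : ∀ D, 0 ≤ g D := by
    intro D
    have h2 := Nat.mod_lt D (show 0 < s by omega)
    simp only [g]
    split_ifs
    · positivity
    · exact mul_nonneg (by omega) (by omega)
  have hstep : ∀ D, 2 * (s : ℤ) * (longSteps s (D + 1) : ℤ) + g (D + 1) ≤ 2 * (D + 1) + g D := by
    intro D
    have hD : (D : ℤ) = s * (D / s : ℕ) + (D % s : ℕ) := by
      exact_mod_cast (Nat.div_add_mod D s).symm
    have hg0 := hg D
    rcases div_mod_succ (show 0 < s by omega) D with ⟨h1, h2, h3⟩ | ⟨h1, h2, h3⟩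
    · simp only [g, longSteps, h2, h3]
      generalize D / s = q at *
      generalize D % s = j at *
      by_cases c1 : j + 1 ≤ s / 2
      · rw [if_pos c1, if_pos c1, if_pos (by omega)]
        push_cast
        nlinarith
      · rw [if_neg c1, if_neg c1]
        by_cases c2 : j ≤ s / 2
        · rw [if_pos c2]
          obtain rfl : j = s / 2 := by omega
          rcases Nat.even_or_odd' s with ⟨h, rfl | rfl⟩
          · rw [show 2 * h / 2 = h by omega] at *
            push_cast at *
            nlinarith
          · rw [show (2 * h + 1) / 2 = h by omega] at *
            push_cast at *
            nlinarith
        · rw [if_neg c2]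
          push_cast
          nlinarith
    · have hg1 : g (D + 1) = 0 := by
        simp only [g, h3]
        rw [if_pos (Nat.zero_le _)]
        simp
      have h4 : longSteps s (D + 1) = D / s + 1 := by simp [longSteps, h2, h3]
      rw [hg1, h4]
      have : ((D % s : ℕ) : ℤ) + 1 = s := by exact_mod_cast h1
      push_cast
      push_cast at hD
      nlinarith
  have key : ∀ D, 2 * (s : ℤ) * ((∑ d ∈ Icc 1 D, longSteps s d : ℕ) : ℤ) + g D ≤ D * (D + 1) := by
    intro D
    induction D with
    | zero => simp [g]
    | succ D ih =>
      rw [sum_Icc_succ_top (by omega), Nat.cast_add]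
      have := hstep D
      push_cast at *
      nlinarith
  have h1 := key D
  have h2 := hg D
  have : (2 * (s : ℤ) * ((∑ d ∈ Icc 1 D, longSteps s d : ℕ) : ℤ)) ≤ D * (D + 1) := by linarith
  exact_mod_cast this

/-- For `s = 2` the cut alone uses up the whole factor `(s + 1) / s = 3 / 2`, so the bound `D * (D +
1)` would not do for arcs. -/
theorem sum_longSteps_two_le (D : ℕ) : 4 * ∑ d ∈ Icc 1 D, longSteps 2 d ≤ D * D := by
  have h : ∀ d, longSteps 2 d = d / 2 := fun d => by
    rw [longSteps, if_pos (by omega)]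
  simp only [h]
  have key : 4 * ∑ d ∈ Icc 1 D, d / 2 + D % 2 ≤ D * D := by
    induction D with
    | zero => simp
    | succ D ih =>
      rw [sum_Icc_succ_top (by omega)]
      have : (D + 1) * (D + 1) = D * D + 2 * D + 1 := by ring
      omega
  omega

/-- Dropping both ends and subtracting `1` from each term takes `s + 2` to `s`. Two consecutive
cases are carried together for this induction by steps of two. -/
theorem sum_min_sub (s : ℕ) :
    ∑ j ∈ range s, min j (s - j) = (s / 2) * (s - s / 2) ∧
    ∑ j ∈ range (s + 1), min j (s + 1 - j) = ((s + 1) / 2) * (s + 1 - (s + 1) / 2) := by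
  induction s with
  | zero => simp
  | succ s ih =>
    refine ⟨ih.2, ?_⟩
    rw [sum_range_succ', sum_range_succ]
    have h : ∑ j ∈ range s, min (j + 1) (s + 1 + 1 - (j + 1)) = ∑ j ∈ range s, (min j (s - j) + 1) :=
      sum_congr rfl fun j hj => by
        rw [mem_range] at hj
        omega
    rw [h, sum_add_distrib, ih.1]
    simp only [sum_const, card_range, smul_eq_mul]
    have e1 : (s + 1 + 1) / 2 = s / 2 + 1 := by omega
    have e2 : s + 1 + 1 - (s / 2 + 1) = (s - s / 2) + 1 := by omega
    have e3 : min (s + 1) (s + 1 + 1 - (s + 1)) = 1 := by omega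
    rw [e1, e2, e3]
    have e4 : s / 2 + (s - s / 2) = s := by omega
    have : (s / 2 + 1) * (s - s / 2 + 1) = s / 2 * (s - s / 2) + (s / 2 + (s - s / 2)) + 1 := by ring
    rw [this, e4]
    simp

/-- `unitSteps` is the distance to the nearest multiple of `s`; the interval up to `D` is covered by
`D / s + 1` full periods. -/
theorem sum_unitSteps_le {s : ℕ} (hs : 2 ≤ s) (D : ℕ) :
    ∑ d ∈ Icc 1 D, unitSteps s d ≤ (D / s + 1) * (s / 2 * (s - s / 2)) := by
  have hblock : ∀ q, ∑ d ∈ range (q * s), unitSteps s d = q * (s / 2 * (s - s / 2)) := by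
    intro q
    induction q with
    | zero => simp
    | succ q ih =>
      rw [add_mul, one_mul, sum_range_add, ih, ← (sum_min_sub s).1, add_mul, one_mul]
      congr 1
      refine sum_congr rfl fun j hj => ?_
      rw [mem_range] at hj
      have : (q * s + j) % s = j := by
        rw [mul_comm, Nat.mul_add_mod, Nat.mod_eq_of_lt hj]
      rw [unitSteps, this]
      split_ifs <;> omega
  rw [← hblock]
  refine sum_le_sum_of_subset fun d hd => ?_
  rw [mem_Icc] at hd
  rw [mem_range]
  have h1 := Nat.div_add_mod D s
  have h2 := Nat.mod_lt D (show 0 < s by omega)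
  rw [add_mul, mul_comm (D / s)]
  omega

theorem sum_ball (K : ℕ) : 3 * ∑ k ∈ range K, (2 * k ^ 2 + 2 * k + 1) = 2 * K ^ 3 + K := by
  induction K with
  | zero => simp
  | succ K ih =>
    rw [sum_range_succ, mul_add, ih]
    ring

theorem sixty_four_mul_le {n s : ℕ} (hn : 10000 ≤ n) (h : 2 * s ^ 2 ≤ 3 * n) : 64 * s ≤ n := by
  rcases Nat.lt_or_ge s 96 with h1 | h1
  · omega
  · nlinarith

/-- Shaped to be combined with `Routing.ball_bounds` at `K = s / 2`: by `sum_ball`, `2 * K ^ 3 + K`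
is three times the sum of the ball sizes. -/
theorem sum_unitSteps_bound {n s : ℕ} (hn : 10000 ≤ n) (hs : 2 ≤ s) (h : 2 * s ^ 2 ≤ 3 * n) :
    8 * ∑ d ∈ Icc 1 (n / 2), unitSteps s d + (2 * (s / 2) ^ 3 + s / 2) ≤ 3 * (n * (s / 2)) := by
  have h1 := sum_unitSteps_le hs (n / 2)
  have h2 : 2 * (n / 2 / s * s) ≤ n := by
    have := Nat.div_mul_le_self (n / 2) s
    omega
  have h3 := sixty_four_mul_le hn h
  generalize n / 2 / s = q at *
  generalize hK : s / 2 = K at *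
  -- The claim divided by `K`. The left side is about `2n + s² / 2 ≤ 11n / 4`. For small `s` the
  -- excess of `s - K` over `s / 2` matters, so those cases are checked one by one.
  have key : 8 * ((q + 1) * (s - K)) + 2 * K ^ 2 + 1 ≤ 3 * n := by
    rcases Nat.lt_or_ge s 16 with h4 | h4
    · interval_cases s <;> norm_num at hK <;> subst hK <;> norm_num <;> omega
    · have h5 : 2 * (s - K) ≤ s + 1 := by omega
      have h6 : (q + 1) * (2 * (s - K)) ≤ (q + 1) * (s + 1) := Nat.mul_le_mul_left _ h5
      have h7 : 2 * K ≤ s := by omega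
      have h8 : 4 * K ^ 2 ≤ s ^ 2 := by nlinarith
      have h9 : q * 16 ≤ q * s := Nat.mul_le_mul_left _ h4
      nlinarith
  calc 8 * ∑ d ∈ Icc 1 (n / 2), unitSteps s d + (2 * K ^ 3 + K)
      ≤ 8 * ((q + 1) * (K * (s - K))) + (2 * K ^ 3 + K) := by omega
    _ = (8 * ((q + 1) * (s - K)) + 2 * K ^ 2 + 1) * K := by ring
    _ ≤ 3 * n * K := Nat.mul_le_mul_right _ key
    _ = 3 * (n * K) := by ring

end Sums

/-! ### Comparison of the upper and lower bounds. -/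

section Approximation

variable {n s : ℕ}

theorem FollowsRoute.approximation [NeZero n] (hn : 10000 ≤ n) (hs : 2 ≤ s) (h : 2 * s ^ 2 ≤ 3 * n)
    {R : Routing (circulant n s)} (hR : FollowsRoute R) (R' : Routing (circulant n s)) :
    2 * R.maxEdgeLoad ≤ 3 * R'.maxEdgeLoad ∧ 2 * R.maxArcLoad ≤ 3 * R'.maxArcLoad := by
  have h64 := sixty_four_mul_le hn h
  have hE := hR.maxEdgeLoad_le hs (by omega)
  have hA := hR.maxArcLoad_le hs (by omega)
  obtain ⟨hcA, hcE⟩ := R'.cut_bounds (m := n / 2) (by omega)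
  obtain ⟨hbA, hbE⟩ := R'.ball_bounds (s / 2)
  have hQ := sum_ball (s / 2)
  have hu := sum_unitSteps_bound hn hs h
  have hl := sum_longSteps_le hs (n / 2)
  have hl' := sum_longSteps_le hs ((n - 1) / 2)
  have hl2 := sum_longSteps_two_le (n / 2)
  generalize R.maxEdgeLoad = E at *
  generalize R.maxArcLoad = C at *
  generalize R'.maxEdgeLoad = E' at *
  generalize R'.maxArcLoad = C' at *
  generalize ∑ d ∈ Icc 1 (n / 2), unitSteps s d = A at *
  rw [le_max_iff] at hE hA
  obtain ⟨D, hD⟩ : ∃ D, D = n / 2 := ⟨_, rfl⟩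
  constructor
  · rcases hE with hE | hE
    · have hB : s * (∑ d ∈ Icc 1 (n / 2), longSteps s d +
          ∑ d ∈ Icc 1 ((n - 1) / 2), longSteps s d) ≤ n / 2 * (n - n / 2) := by
        rcases Nat.even_or_odd' n with ⟨m, hm | hm⟩
        · obtain ⟨t, rfl⟩ : ∃ t, m = t + 1 := ⟨m - 1, by omega⟩
          rw [show n / 2 = t + 1 by omega, show n - (t + 1) = t + 1 by omega,
            show (n - 1) / 2 = t by omega] at *
          nlinarith
        · rw [show n / 2 = m by omega, show n - m = m + 1 by omega,
            show (n - 1) / 2 = m by omega] at *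
          nlinarith
      have h1 : s * E ≤ (s + 1) * E' := ((Nat.mul_le_mul_left _ hE).trans hB).trans hcE
      refine Nat.le_of_mul_le_mul_left (c := s) ?_ (by omega)
      nlinarith [Nat.mul_le_mul_right E' hs]
    · omega
  · rcases hA with hA | hA
    · rcases hs.lt_or_eq with hs3 | rfl
      · have h1 : 2 * s * C ≤ n / 2 * (n / 2 + 1) := (Nat.mul_le_mul_left _ hA).trans hl
        have h2 : n / 2 * (n / 2) ≤ 2 * (s + 1) * C' :=
          (Nat.mul_le_mul_left _ (by omega)).trans hcA
        rw [← hD] at h1 h2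
        have hD8 : 8 ≤ D := by omega
        -- The product of `(D + 1) / D` and `(s + 1) / s` is at most `9 / 8 * 4 / 3 = 3 / 2`, with
        -- equality at `D = 8`, `s = 3`.
        have h3 : 2 * ((D + 1) * (s + 1)) ≤ 3 * (D * s) := by
          obtain ⟨u, rfl⟩ : ∃ u, s = u + 3 := ⟨s - 3, by omega⟩
          obtain ⟨v, rfl⟩ : ∃ v, D = v + 8 := ⟨D - 8, by omega⟩
          nlinarith [Nat.zero_le (u * v)]
        refine Nat.le_of_mul_le_mul_left (c := (s + 1) * s) ?_ (by positivity)
        have h4 : 2 * (s + 1) * (2 * s * C) ≤ 2 * (s + 1) * (D * (D + 1)) :=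
          Nat.mul_le_mul_left _ h1
        have h5 : D * (2 * ((D + 1) * (s + 1))) ≤ D * (3 * (D * s)) := Nat.mul_le_mul_left _ h3
        have h6 : 3 * s * (D * D) ≤ 3 * s * (2 * (s + 1) * C') := Nat.mul_le_mul_left _ h2
        nlinarith
      · have h2 : n / 2 * (n / 2) ≤ n / 2 * (n - n / 2) := Nat.mul_le_mul_left _ (by omega)
        omega
    · omega

end Approximation

/-! ### Total correctness of programs with step counts. -/

section WeakestPrecondition

/-- The program `p`, started in `σ`, halts after `t` steps in a state `τ` such that `Q t τ`. -/
def WP (p : Program) (Q : ℕ → State → Prop) (σ : State) : Prop :=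
  ∃ t τ, Runs p σ t τ ∧ Q t τ

variable {Q Q' : ℕ → State → Prop} {σ : State} {p q : Program} {i j k : ℕ}

theorem WP.mono (h : WP p Q σ) (hQ : ∀ t τ, Q t τ → Q' t τ) : WP p Q' σ := by
  obtain ⟨t, τ, hr, hq⟩ := h
  exact ⟨t, τ, hr, hQ t τ hq⟩

theorem wp_const {c : ℕ} (h : Q 1 (σ.set i c)) : WP (.const i c) Q σ := ⟨_, _, .const _ _ _, h⟩

theorem wp_add (h : Q 1 (σ.set i (σ.reg j + σ.reg k))) : WP (.add i j k) Q σ :=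
  ⟨_, _, .add _ _ _ _, h⟩

theorem wp_sub (h : Q 1 (σ.set i (σ.reg j - σ.reg k))) : WP (.sub i j k) Q σ :=
  ⟨_, _, .sub _ _ _ _, h⟩

theorem wp_write (h : Q 1 ⟨σ.reg, σ.out ++ [σ.reg i]⟩) : WP (.write i) Q σ :=
  ⟨_, _, .write _ _, h⟩

theorem wp_seq (h : WP p (fun t τ => WP q (fun u υ => Q (t + u) υ) τ) σ) : WP (.seq p q) Q σ := by
  obtain ⟨t, τ, hr, u, υ, hr', hq⟩ := h
  exact ⟨_, _, .seq hr hr', hq⟩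

theorem wp_ite (h : σ.reg i < σ.reg j → WP p (fun t τ => Q (t + 1) τ) σ)
    (h' : ¬ σ.reg i < σ.reg j → WP q (fun t τ => Q (t + 1) τ) σ) : WP (.ite i j p q) Q σ := by
  by_cases c : σ.reg i < σ.reg j
  · obtain ⟨t, τ, hr, hq⟩ := h c
    exact ⟨_, _, .iteTrue c hr, hq⟩
  · obtain ⟨t, τ, hr, hq⟩ := h' c
    exact ⟨_, _, .iteFalse c hr, hq⟩

/-- A loop whose invariant `I` records the number of remaining iterations, each of which takes at
most `B` steps. -/
theorem wp_loop (I : ℕ → State → Prop) (B : ℕ) (h0 : ∀ σ, I 0 σ → ¬ σ.reg i < σ.reg j)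
    (hs : ∀ r σ, I (r + 1) σ → σ.reg i < σ.reg j ∧ WP p (fun t τ => t ≤ B ∧ I r τ) σ)
    (r : ℕ) (h : I r σ) : WP (.loop i j p) (fun t τ => t ≤ r * (B + 1) + 1 ∧ I 0 τ) σ := by
  induction r generalizing σ with
  | zero => exact ⟨_, _, .loopFalse (h0 σ h), by omega, h⟩
  | succ r ih =>
    obtain ⟨hc, t, τ, hr, ht, hI⟩ := hs r σ h
    obtain ⟨u, υ, hr', hu, hI'⟩ := ih hI
    exact ⟨_, _, .loopTrue hc hr hr', by rw [add_mul]; omega, hI'⟩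

end WeakestPrecondition

/-! ### The register program and its invariants. -/

section Programs

/-- `r_4 := r_4 + r_k` modulo `r_0`, followed by the output of `r_4`. -/
def advanceProgram (k : ℕ) : Program :=
  .seq (.add 4 4 k) (.ite 4 0 (.write 4) (.seq (.sub 4 4 0) (.write 4)))

/-- Output of the path from `r_2` to `r_2 + r_12`. -/
def pathProgram : Program :=
  -- Roles of the registers: `r_4` current vertex, `r_5` remaining distance, `r_6` and `r_7` the
  -- long and unit steps modulo `n`, `r_8 = 0`, `r_9 = 1`, `r_10 = s - 1`, `r_11` scratch, `r_12 =
  -- d`. The first test is `n < 2d`.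
  .seq (.add 11 12 12) <|
  .seq (.ite 0 11 (.seq (.sub 5 0 12) (.seq (.sub 6 0 1) (.sub 7 0 9)))
    (.seq (.add 5 12 8) (.seq (.add 6 1 8) (.add 7 9 8)))) <|
  .seq (.add 4 2 8) <|
  .seq (.write 4) <|
  -- The guard `s - 1 < r_5` means `s ≤ r_5`, so the loop leaves the remainder `j` in `r_5`. The
  -- next test `s < 2j` is `j > ⌊s / 2⌋`; its other branch only resets scratch.
  .seq (.loop 10 5 (.seq (.sub 5 5 1) (advanceProgram 6))) <|
  .seq (.add 11 5 5) <|
  .seq (.ite 1 11 (.seq (.sub 5 1 5) (.seq (.sub 7 0 7) (advanceProgram 6))) (.const 11 0)) <|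
  .seq (.loop 8 5 (.seq (.sub 5 5 9) (advanceProgram 7)))
  (.write 0)

/-- Output of the path from `r_2` to `r_3` if these are different. -/
def pairProgram : Program :=
  .ite 2 3 (.seq (.sub 12 3 2) pathProgram)
    -- Adding `n` before subtracting `x` keeps the truncated subtraction exact.
    (.ite 3 2 (.seq (.add 12 3 0) (.seq (.sub 12 12 2) pathProgram)) (.const 11 0))

/-- Output of all paths that start at `r_2`. -/
def rowProgram : Program := .seq (.const 3 0) (.loop 3 0 (.seq pairProgram (.add 3 3 9)))

/-- Output of the routing of `C_n(1, s)`, where `r_0 = n` and `r_1 = s`. -/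
def routingProgram : Program :=
  .seq (.const 9 1) (.seq (.sub 10 1 9) (.loop 2 0 (.seq rowProgram (.add 2 2 9))))

/-- The contents of the registers that the programs for single paths do not change. -/
structure Frame (n s x y : ℕ) (σ : State) : Prop where
  r0 : σ.reg 0 = n
  r1 : σ.reg 1 = s
  r2 : σ.reg 2 = x
  r3 : σ.reg 3 = y
  r8 : σ.reg 8 = 0
  r9 : σ.reg 9 = 1
  r10 : σ.reg 10 = s - 1

variable {n s x y : ℕ} {σ : State}

theorem State.set_reg_self (σ : State) (i v : ℕ) : (σ.set i v).reg i = v :=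
  Function.update_self ..

theorem State.set_reg_of_ne (σ : State) {i j : ℕ} (v : ℕ) (h : j ≠ i) :
    (σ.set i v).reg j = σ.reg j :=
  Function.update_of_ne h ..

theorem State.set_out (σ : State) (i v : ℕ) : (σ.set i v).out = σ.out := rfl

theorem Frame.set (h : Frame n s x y σ) (i v : ℕ)
    (hi : i ∉ ({0, 1, 2, 3, 8, 9, 10} : Finset ℕ) := by decide) : Frame n s x y (σ.set i v) := by
  simp only [Finset.mem_insert, Finset.mem_singleton, not_or] at hi
  constructor
  · rw [State.set_reg_of_ne _ _ (by omega), h.r0]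
  · rw [State.set_reg_of_ne _ _ (by omega), h.r1]
  · rw [State.set_reg_of_ne _ _ (by omega), h.r2]
  · rw [State.set_reg_of_ne _ _ (by omega), h.r3]
  · rw [State.set_reg_of_ne _ _ (by omega), h.r8]
  · rw [State.set_reg_of_ne _ _ (by omega), h.r9]
  · rw [State.set_reg_of_ne _ _ (by omega), h.r10]

theorem Frame.output (h : Frame n s x y σ) (w : List ℕ) : Frame n s x y ⟨σ.reg, w⟩ :=
  ⟨h.r0, h.r1, h.r2, h.r3, h.r8, h.r9, h.r10⟩

theorem wp_advance [NeZero n] {k : ℕ} {Q : ℕ → State → Prop} (a c : ZMod n)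
    (h0 : σ.reg 0 = n) (h4 : σ.reg 4 = a.val) (hk : σ.reg k = c.val)
    (hQ : ∀ t, t ≤ 4 → Q t ⟨Function.update σ.reg 4 (a + c).val, σ.out ++ [(a + c).val]⟩) :
    WP (advanceProgram k) Q σ := by
  have ha := a.val_lt
  have hc := c.val_lt
  refine wp_seq (wp_add (wp_ite (fun hlt => wp_write ?_)
    fun hlt => wp_seq (wp_sub (wp_write ?_))))
  all_goals
    rw [State.set_reg_self, State.set_reg_of_ne _ _ (by decide), h0, h4, hk] at hlt
    simp only [State.set, Function.update_self, h4, hk]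
  · rw [← Nat.mod_eq_of_lt hlt, ← ZMod.val_add]
    exact hQ _ (by omega)
  · have e : (a + c).val = a.val + c.val - n := by
      rw [ZMod.val_add, Nat.mod_eq_sub_mod (by omega), Nat.mod_eq_of_lt (by omega)]
    rw [Function.update_of_ne (by decide), h0, Function.update_idem, ← e]
    exact hQ _ (by omega)

/-- The first `k + 1` vertices of a path, as numbers. -/
def vertexCode (n s : ℕ) (x : ZMod n) (d k : ℕ) : List ℕ :=
  (List.range (k + 1)).map fun i => (routeVertex n s x d i).val

theorem vertexCode_succ (x : ZMod n) (d k : ℕ) :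
    vertexCode n s x d (k + 1) = vertexCode n s x d k ++ [(routeVertex n s x d (k + 1)).val] := by
  rw [vertexCode, List.range_succ, List.map_append]
  rfl

/-- The state in which the program for the path from `x` to `x + d` has reached the `k`-th vertex,
with `e` in the register that controls the loops. -/
structure PathState (n s x y d : ℕ) (w : List ℕ) (u : ZMod n) (k e : ℕ) (σ : State) : Prop where
  frame : Frame n s x y σ
  r4 : σ.reg 4 = (routeVertex n s x d k).val
  r5 : σ.reg 5 = e
  r6 : σ.reg 6 = (cycleSign n d * s : ZMod n).val
  r7 : σ.reg 7 = u.val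
  out : σ.out = w ++ vertexCode n s x d k

theorem PathState.advance [NeZero n] {d k e : ℕ} {w : List ℕ} {u c : ZMod n} {r : ℕ}
    {Q : ℕ → State → Prop} (h : PathState n s x y d w u k e σ)
    (hr : σ.reg r = c.val) (hs : 0 < s)
    (hk : k < routeLength n s d) (hc : routeStep n s d k = c)
    (hQ : ∀ t τ, t ≤ 4 → PathState n s x y d w u (k + 1) e τ → Q t τ) :
    WP (advanceProgram r) Q σ := by
  refine wp_advance (routeVertex n s x d k) c h.frame.r0 h.r4 hr fun t ht => hQ t _ ht ?_
  rw [← hc, ← routeVertex_succ hs _ hk]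
  refine ⟨((h.frame.set 4 _).output _), State.set_reg_self σ 4 _, ?_, ?_, ?_, ?_⟩
  · exact (State.set_reg_of_ne σ _ (by decide)).trans h.r5
  · exact (State.set_reg_of_ne σ _ (by decide)).trans h.r6
  · exact (State.set_reg_of_ne σ _ (by decide)).trans h.r7
  · rw [vertexCode_succ, ← List.append_assoc, ← h.out]

theorem PathState.set_five {d k e : ℕ} {w : List ℕ} {u : ZMod n}
    (h : PathState n s x y d w u k e σ) (v : ℕ) : PathState n s x y d w u k v (σ.set 5 v) := by
  refine ⟨h.frame.set 5 v, ?_, State.set_reg_self .., ?_, ?_, ?_⟩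
  · rw [State.set_reg_of_ne _ _ (by decide), h.r4]
  · rw [State.set_reg_of_ne _ _ (by decide), h.r6]
  · rw [State.set_reg_of_ne _ _ (by decide), h.r7]
  · rw [State.set_out, h.out]

theorem PathState.set_eleven {d k e : ℕ} {w : List ℕ} {u : ZMod n}
    (h : PathState n s x y d w u k e σ) (v : ℕ) : PathState n s x y d w u k e (σ.set 11 v) := by
  refine ⟨h.frame.set 11 v, ?_, ?_, ?_, ?_, ?_⟩
  · rw [State.set_reg_of_ne _ _ (by decide), h.r4]
  · rw [State.set_reg_of_ne _ _ (by decide), h.r5]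
  · rw [State.set_reg_of_ne _ _ (by decide), h.r6]
  · rw [State.set_reg_of_ne _ _ (by decide), h.r7]
  · rw [State.set_out, h.out]

theorem PathState.set_seven {d k e : ℕ} {w : List ℕ} {u : ZMod n}
    (h : PathState n s x y d w u k e σ) (u' : ZMod n) :
    PathState n s x y d w u' k e (σ.set 7 u'.val) := by
  refine ⟨h.frame.set 7 _, ?_, ?_, ?_, State.set_reg_self .., ?_⟩
  · rw [State.set_reg_of_ne _ _ (by decide), h.r4]
  · rw [State.set_reg_of_ne _ _ (by decide), h.r5]
  · rw [State.set_reg_of_ne _ _ (by decide), h.r6]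
  · rw [State.set_out, h.out]

end Programs

/-! ### Correctness and running time of the program. -/

section Correctness

variable {n s x y d : ℕ} {σ : State}

theorem neg_val_of_pos [NeZero n] {a : ZMod n} {m : ℕ} (ha : a.val = m) (hm : 0 < m) :
    (-a).val = n - m := by
  have h0 : a ≠ 0 := by
    rintro rfl
    rw [ZMod.val_zero] at ha
    omega
  rw [ZMod.neg_val, if_neg h0, ha]

theorem val_one_of_lt (h : 1 < n) : (1 : ZMod n).val = 1 := by
  have : Fact (1 < n) := ⟨h⟩
  exact ZMod.val_one n

theorem neg_cycleSign_val [NeZero n] (hn : 1 < n) (d : ℕ) :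
    (-cycleSign n d).val = n - (cycleSign n d).val := by
  unfold cycleSign
  split_ifs
  · exact neg_val_of_pos rfl (by rw [val_one_of_lt hn]; omega)
  · rw [neg_neg, neg_val_of_pos (val_one_of_lt hn) one_pos, val_one_of_lt hn]
    omega

theorem wp_orient [NeZero n] (hs : 0 < s) (hn : s < n) (hσ : Frame n s x y σ)
    (h12 : σ.reg 12 = d) (h11 : σ.reg 11 = d + d) :
    WP (.ite 0 11 (.seq (.sub 5 0 12) (.seq (.sub 6 0 1) (.sub 7 0 9)))
      (.seq (.add 5 12 8) (.seq (.add 6 1 8) (.add 7 9 8))))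
      (fun t τ => t = 4 ∧ Frame n s x y τ ∧ τ.reg 5 = cycleNorm n d ∧
        τ.reg 6 = (cycleSign n d * s : ZMod n).val ∧ τ.reg 7 = (cycleSign n d).val ∧
        τ.out = σ.out) σ := by
  have e0 := hσ.r0
  have e1 := hσ.r1
  have e8 := hσ.r8
  have e9 := hσ.r9
  have es : ((s : ZMod n)).val = s := ZMod.val_cast_of_lt hn
  have eo : (1 : ZMod n).val = 1 := val_one_of_lt (by omega)
  refine wp_ite (fun h => wp_seq (wp_sub (wp_seq (wp_sub (wp_sub ?_)))))
    fun h => wp_seq (wp_add (wp_seq (wp_add (wp_add ?_))))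
  all_goals
    rw [h11, e0] at h
    refine ⟨rfl, ((hσ.set 5 _).set 6 _).set 7 _, ?_, ?_, ?_, rfl⟩
  all_goals simp only [cycleNorm, cycleSign]
  · rw [if_neg (by omega)]
    simp [State.set, Function.update, e0, h12]
  · rw [if_neg (by omega), neg_one_mul, neg_val_of_pos es hs]
    simp [State.set, Function.update, e0, e1]
  · rw [if_neg (by omega), neg_val_of_pos eo one_pos]
    simp [State.set, Function.update, e0, e9]
  · rw [if_pos (by omega)]
    simp [State.set, Function.update, e8, h12]
  · rw [if_pos (by omega), one_mul, es]
    simp [State.set, Function.update, e8, e1]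
  · rw [if_pos (by omega), eo]
    simp [State.set, Function.update, e8, e9]

theorem wp_longLoop [NeZero n] {w : List ℕ} {u : ZMod n} (hs : 0 < s)
    (hσ : PathState n s x y d w u 0 (cycleNorm n d) σ) :
    WP (.loop 10 5 (.seq (.sub 5 5 1) (advanceProgram 6)))
      (fun t τ => t ≤ cycleNorm n d / s * 6 + 1 ∧
        PathState n s x y d w u (cycleNorm n d / s) (cycleNorm n d % s) τ) σ := by
  set e := cycleNorm n d with he
  have hlong : e / s ≤ longSteps s e := by
    unfold longSteps
    split_ifs <;> omega
  have hmod : e % s < s := Nat.mod_lt _ hs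
  have hdm : e / s * s + e % s = e := by rw [mul_comm]; exact Nat.div_add_mod e s
  refine (wp_loop (fun r τ => r ≤ e / s ∧ PathState n s x y d w u (e / s - r) (r * s + e % s) τ) 5
    ?_ ?_ (e / s) ⟨le_rfl, by rw [Nat.sub_self, hdm]; exact hσ⟩).mono ?_
  · rintro τ ⟨-, h⟩
    rw [h.frame.r10, h.r5]
    omega
  · rintro r τ ⟨hr, h⟩
    have hmul : (r + 1) * s = r * s + s := by ring
    refine ⟨by rw [h.frame.r10, h.r5]; omega, wp_seq (wp_sub ?_)⟩
    have e5 : τ.reg 5 - τ.reg 1 = r * s + e % s := by rw [h.r5, h.frame.r1]; omega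
    rw [e5]
    refine (h.set_five (r * s + e % s)).advance (h.set_five _).r6 hs ?_ ?_ fun t υ ht hυ => ?_
    · rw [routeLength, ← he]; omega
    · rw [routeStep, ← he, if_pos (by omega)]
    · rw [show e / s - (r + 1) + 1 = e / s - r by omega] at hυ
      exact ⟨by omega, by omega, hυ⟩
  · rintro t τ ⟨ht, -, h⟩
    rw [Nat.sub_zero, zero_mul, zero_add] at h
    exact ⟨ht, h⟩

theorem wp_turn [NeZero n] {w : List ℕ} (hs : 0 < s) (hn : s < n)
    (hσ : PathState n s x y d w (cycleSign n d) (cycleNorm n d / s) (cycleNorm n d % s) σ)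
    (h11 : σ.reg 11 = cycleNorm n d % s + cycleNorm n d % s) :
    WP (.ite 1 11 (.seq (.sub 5 1 5) (.seq (.sub 7 0 7) (advanceProgram 6))) (.const 11 0))
      (fun t τ => t ≤ 7 ∧ PathState n s x y d w
        (cycleSign n d * if cycleNorm n d % s ≤ s / 2 then 1 else -1)
        (longSteps s (cycleNorm n d)) (unitSteps s (cycleNorm n d)) τ) σ := by
  set e := cycleNorm n d with he
  refine wp_ite (fun h => ?_) fun h => wp_const ?_
  · rw [hσ.frame.r1, h11] at h
    have hlt : ¬ e % s ≤ s / 2 := by omega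
    have hl : longSteps s e = e / s + 1 := if_neg hlt
    have hu : unitSteps s e = s - e % s := if_neg hlt
    rw [if_neg hlt, mul_neg_one]
    refine wp_seq (wp_sub (wp_seq (wp_sub ?_)))
    have e5 : σ.reg 1 - σ.reg 5 = unitSteps s e := by rw [hσ.r5, hσ.frame.r1, hu]
    rw [e5]
    have h1 := hσ.set_five (unitSteps s e)
    have e7 : (σ.set 5 (unitSteps s e)).reg 0 - (σ.set 5 (unitSteps s e)).reg 7 =
        (-cycleSign n d).val := by
      rw [h1.frame.r0, h1.r7, neg_cycleSign_val (by omega)]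
    rw [e7]
    have h2 := h1.set_seven (-cycleSign n d)
    refine h2.advance h2.r6 hs ?_ ?_ fun t υ ht hυ => ?_
    · rw [routeLength, ← he]; omega
    · rw [routeStep, ← he, if_pos (by omega)]
    · rw [← hl] at hυ
      exact ⟨by omega, hυ⟩
  · rw [hσ.frame.r1, h11] at h
    have hle : e % s ≤ s / 2 := by omega
    have hl : longSteps s e = e / s := if_pos hle
    have hu : unitSteps s e = e % s := if_pos hle
    rw [if_pos hle, mul_one, hl, hu]
    exact ⟨by omega, hσ.set_eleven 0⟩

theorem wp_unitLoop [NeZero n] {w : List ℕ} (hs : 0 < s)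
    (hσ : PathState n s x y d w (cycleSign n d * if cycleNorm n d % s ≤ s / 2 then 1 else -1)
      (longSteps s (cycleNorm n d)) (unitSteps s (cycleNorm n d)) σ) :
    WP (.loop 8 5 (.seq (.sub 5 5 9) (advanceProgram 7)))
      (fun t τ => t ≤ unitSteps s (cycleNorm n d) * 6 + 1 ∧ Frame n s x y τ ∧
        τ.out = w ++ vertexCode n s x d (routeLength n s d)) σ := by
  set e := cycleNorm n d with he
  set u : ZMod n := cycleSign n d * if e % s ≤ s / 2 then 1 else -1 with hu
  have hlen : routeLength n s d = longSteps s e + unitSteps s e := rfl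
  refine (wp_loop (fun r τ => r ≤ unitSteps s e ∧
    PathState n s x y d w u (routeLength n s d - r) r τ) 5 ?_ ?_ (unitSteps s e)
    ⟨le_rfl, by rw [hlen, Nat.add_sub_cancel]; exact hσ⟩).mono ?_
  · rintro τ ⟨-, h⟩
    rw [h.r5]
    omega
  · rintro r τ ⟨hr, h⟩
    refine ⟨by rw [h.frame.r8, h.r5]; omega, wp_seq (wp_sub ?_)⟩
    have e5 : τ.reg 5 - τ.reg 9 = r := by rw [h.r5, h.frame.r9]; omega
    rw [e5]
    refine (h.set_five r).advance (h.set_five r).r7 hs (by omega) ?_ fun t υ ht hυ => ?_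
    · rw [routeStep, ← he, if_neg (by omega)]
    · rw [show routeLength n s d - (r + 1) + 1 = routeLength n s d - r by omega] at hυ
      exact ⟨by omega, by omega, hυ⟩
  · rintro t τ ⟨ht, -, h⟩
    exact ⟨ht, h.frame, h.out⟩

theorem wp_path [NeZero n] (hs : 0 < s) (hn : s < n) (hx : x < n) (hσ : Frame n s x y σ)
    (h12 : σ.reg 12 = d) :
    WP pathProgram (fun t τ => t ≤ 12 * n + 20 ∧ Frame n s x y τ ∧
      τ.out = σ.out ++ (vertexCode n s x d (routeLength n s d) ++ [n])) σ := by
  have hc : cycleNorm n d ≤ n / 2 := cycleNorm_le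
  have hdiv := Nat.div_le_self (cycleNorm n d) s
  have hus := unitSteps_le s (cycleNorm n d)
  refine wp_seq (wp_add (wp_seq ((wp_orient (d := d) hs hn (hσ.set 11 _) ?_ ?_).mono ?_)))
  · rw [State.set_reg_of_ne _ _ (by decide), h12]
  · rw [State.set_reg_self, h12]
  rintro t1 τ ⟨rfl, hτ, t5, t6, t7, tout⟩
  refine wp_seq (wp_add (wp_seq (wp_write (wp_seq ?_))))
  have hv : (routeVertex n s x d 0).val = x := by
    rw [routeVertex_zero, ZMod.val_cast_of_lt hx]
  have h1 : PathState n s x y d σ.out (cycleSign n d) 0 (cycleNorm n d)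
      ⟨(τ.set 4 (τ.reg 2 + τ.reg 8)).reg, (τ.set 4 (τ.reg 2 + τ.reg 8)).out ++
        [(τ.set 4 (τ.reg 2 + τ.reg 8)).reg 4]⟩ := by
    rw [hτ.r2, hτ.r8, add_zero, State.set_reg_self]
    refine ⟨(hτ.set 4 x).output _, ?_, ?_, ?_, ?_, ?_⟩
    · rw [hv]
      exact State.set_reg_self τ 4 x
    · exact (State.set_reg_of_ne (i := 4) τ x (by decide)).trans t5
    · exact (State.set_reg_of_ne (i := 4) τ x (by decide)).trans t6
    · exact (State.set_reg_of_ne (i := 4) τ x (by decide)).trans t7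
    · simp [State.set_out, tout, vertexCode, hv]
  refine (wp_longLoop hs h1).mono ?_
  rintro t2 υ ⟨ht2, hυ⟩
  refine wp_seq (wp_add (wp_seq ((wp_turn hs hn (hυ.set_eleven _) ?_).mono ?_)))
  · rw [State.set_reg_self, hυ.r5]
  rintro t3 φ ⟨ht3, hφ⟩
  refine wp_seq ((wp_unitLoop hs hφ).mono ?_)
  rintro t4 ψ ⟨ht4, hψ, hout⟩
  refine wp_write ⟨by omega, hψ.output _, ?_⟩
  simp only [hψ.r0, hout, List.append_assoc]

/-- The part of the output that describes the path from `x` to `y`. -/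
def pairCode (n s x y : ℕ) : List ℕ :=
  if (x : ZMod n) ≠ (y : ZMod n) then (routePath n s x y).map ZMod.val ++ [n] else []

theorem pairCode_of_ne (hx : x < n) (hy : y < n) (hxy : x ≠ y)
    (hd : ((y : ZMod n) - x).val = d) :
    pairCode n s x y = vertexCode n s x d (routeLength n s d) ++ [n] := by
  have h : (x : ZMod n) ≠ y := by
    intro h
    have := congrArg ZMod.val h
    rw [ZMod.val_cast_of_lt hx, ZMod.val_cast_of_lt hy] at this
    exact hxy this
  rw [pairCode, if_pos h, routePath_eq, hd, List.map_map]
  rfl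

theorem wp_pair [NeZero n] (hs : 0 < s) (hn : s < n) (hx : x < n) (hy : y < n)
    (hσ : Frame n s x y σ) :
    WP pairProgram (fun t τ => t ≤ 12 * n + 30 ∧ Frame n s x y τ ∧
      τ.out = σ.out ++ pairCode n s x y) σ := by
  refine wp_ite (fun h => wp_seq (wp_sub ?_)) fun h =>
    wp_ite (fun h' => wp_seq (wp_add (wp_seq (wp_sub ?_)))) fun h' => wp_const ?_
  · rw [hσ.r2, hσ.r3] at h
    have hd : ((y : ZMod n) - x).val = y - x := by
      rw [← Nat.cast_sub h.le, ZMod.val_cast_of_lt (by omega)]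
    refine (wp_path (d := y - x) hs hn hx (hσ.set 12 _) ?_).mono ?_
    · rw [State.set_reg_self, hσ.r2, hσ.r3]
    · rintro t τ ⟨ht, hτ, hout⟩
      exact ⟨by omega, hτ, by rw [hout, pairCode_of_ne hx hy h.ne hd]; rfl⟩
  · rw [hσ.r2, hσ.r3] at h'
    have hd : ((y : ZMod n) - x).val = y + n - x := by
      have : (y : ZMod n) - x = ((y + n - x : ℕ) : ZMod n) := by
        rw [Nat.cast_sub (by omega)]
        simp
      rw [this, ZMod.val_cast_of_lt (by omega)]
    refine (wp_path (d := y + n - x) hs hn hx ((hσ.set 12 _).set 12 _) ?_).mono ?_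
    · rw [State.set_reg_self, State.set_reg_self, State.set_reg_of_ne _ _ (by decide),
        hσ.r2, hσ.r3, hσ.r0]
    · rintro t τ ⟨ht, hτ, hout⟩
      exact ⟨by omega, hτ, by rw [hout, pairCode_of_ne hx hy h'.ne' hd]; rfl⟩
  · rw [hσ.r2, hσ.r3] at h h'
    obtain rfl : x = y := by omega
    exact ⟨by omega, hσ.set 11 0, by simp [pairCode, State.set_out]⟩

theorem wp_row [NeZero n] {y₀ : ℕ} (hs : 0 < s) (hn : s < n) (hx : x < n)
    (hσ : Frame n s x y₀ σ) :
    WP rowProgram (fun t τ => t ≤ n * (12 * n + 32) + 2 ∧ (∃ y₁, Frame n s x y₁ τ) ∧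
      τ.out = σ.out ++ (List.range n).flatMap (pairCode n s x)) σ := by
  have hset : ∀ {y : ℕ} {τ : State} (v : ℕ), Frame n s x y τ → Frame n s x v (τ.set 3 v) := by
    intro y τ v h
    exact ⟨h.r0, h.r1, h.r2, State.set_reg_self .., h.r8, h.r9, h.r10⟩
  refine wp_seq (wp_const ((wp_loop (fun r τ => r ≤ n ∧ Frame n s x (n - r) τ ∧
    τ.out = σ.out ++ (List.range (n - r)).flatMap (pairCode n s x)) (12 * n + 31) ?_ ?_ n
    ?_).mono
    ?_))
  · rintro τ ⟨-, h, -⟩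
    rw [h.r3, h.r0]
    omega
  · rintro r τ ⟨hr, h, hout⟩
    refine ⟨by rw [h.r3, h.r0]; omega, wp_seq ((wp_pair hs hn hx (by omega) h).mono ?_)⟩
    rintro t υ ⟨ht, hυ, hout'⟩
    have e : n - (r + 1) + 1 = n - r := by omega
    refine wp_add ⟨by omega, by omega, ?_, ?_⟩
    · rw [hυ.r3, hυ.r9, e]
      exact hset _ hυ
    · rw [State.set_out, hout', hout, ← e, List.range_succ, List.flatMap_append,
        List.append_assoc]
      simp
  · exact ⟨le_rfl, by rw [Nat.sub_self]; exact hset 0 hσ, by simp [State.set_out]⟩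
  · rintro t τ ⟨ht, -, h, hout⟩
    rw [show 12 * n + 31 + 1 = 12 * n + 32 from rfl] at ht
    exact ⟨by omega, ⟨_, h⟩, by rw [hout, Nat.sub_zero]⟩

theorem wp_routing [NeZero n] (hs : 0 < s) (hn : s < n) :
    WP routingProgram (fun t τ => t ≤ n * (n * (12 * n + 32) + 4) + 3 ∧
      τ.out = (List.range n).flatMap fun x => (List.range n).flatMap (pairCode n s x))
      (State.init n s) := by
  refine wp_seq (wp_const (wp_seq (wp_sub ((wp_loop (fun r τ => r ≤ n ∧
    (∃ y, Frame n s (n - r) y τ) ∧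
    τ.out = (List.range (n - r)).flatMap fun x => (List.range n).flatMap (pairCode n s x))
    (n * (12 * n + 32) + 3) ?_ ?_ n ?_).mono ?_))))
  · rintro τ ⟨-, ⟨y, h⟩, -⟩
    rw [h.r2, h.r0]
    omega
  · rintro r τ ⟨hr, ⟨y, h⟩, hout⟩
    refine ⟨by rw [h.r2, h.r0]; omega, wp_seq ((wp_row hs hn (by omega) h).mono ?_)⟩
    rintro t υ ⟨ht, ⟨y', hυ⟩, hout'⟩
    have e : n - (r + 1) + 1 = n - r := by omega
    refine wp_add ⟨by omega, by omega, ⟨y', ?_⟩, ?_⟩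
    · rw [hυ.r2, hυ.r9, e]
      exact ⟨hυ.r0, hυ.r1, State.set_reg_self .., hυ.r3, hυ.r8, hυ.r9, hυ.r10⟩
    · rw [State.set_out, hout', hout, ← e, List.range_succ, List.flatMap_append]
      simp
  · refine ⟨le_rfl, ⟨0, ?_⟩, ?_⟩
    · rw [Nat.sub_self]
      constructor <;> simp [State.init, State.set, Function.update]
    · simp [State.set_out, State.init]
  · rintro t τ ⟨ht, -, -, hout⟩
    rw [show n * (12 * n + 32) + 3 + 1 = n * (12 * n + 32) + 4 from rfl] at ht
    exact ⟨by omega, by rw [hout, Nat.sub_zero]⟩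

theorem encode_eq [NeZero n] (R : Routing (circulant n s))
    (hR : ∀ (x y : ZMod n) (h : x ≠ y), (R x y h).1.support = routePath n s x y) :
    R.encode = (List.range n).flatMap fun x => (List.range n).flatMap (pairCode n s x) := by
  unfold Routing.encode
  simp only [natCast_list_eq_map, List.flatMap_map]
  congr 1
  funext x
  congr 1
  funext y
  unfold pairCode
  split_ifs with h
  · rw [hR]
  · rfl

end Correctness

end Forwarding

theorem mainTheorem4 :
    ∃ (p : Forwarding.Program) (T : Polynomial ℕ) (N : ℕ), ∀ n s : ℕ,
      N ≤ n → 2 ≤ s → (s : ℝ) ≤ Real.sqrt (3 * (n : ℝ) / 2) →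
        ∃ R : Forwarding.Routing (Forwarding.circulant n s),
          (∀ (x y : ZMod n) (h : x ≠ y),
            (R x y h).1.support = Forwarding.routePath n s x y) ∧
          Forwarding.Computes p n s (T.eval n) R.encode ∧
          (R.maxEdgeLoad : ℝ) ≤
            3 / 2 * (Forwarding.edgeForwardingIndex (Forwarding.circulant n s) : ℝ) ∧
          (R.maxArcLoad : ℝ) ≤
            3 / 2 * (Forwarding.arcForwardingIndex (Forwarding.circulant n s) : ℝ) := by
  open Forwarding in
  -- The polynomial is the step bound of `wp_routing`; `10000` is the threshold of
  -- `sixty_four_mul_le` and `sum_unitSteps_bound`.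
  refine ⟨routingProgram, .X * (.X * (12 * .X + 32) + 4) + 3, 10000, fun n s hn hs hsqrt => ?_⟩
  have : NeZero n := ⟨by omega⟩
  have hsq : 2 * s ^ 2 ≤ 3 * n := by
    rw [Real.le_sqrt (by positivity) (by positivity)] at hsqrt
    have : 2 * (s : ℝ) ^ 2 ≤ 3 * n := by linarith
    exact_mod_cast this
  have h64 := sixty_four_mul_le hn hsq
  obtain ⟨R, hR⟩ := exists_routing (n := n) (s := s) (by omega) (by omega)
  have hfollow : FollowsRoute R := fun x y h => (hR x y h).2
  -- An infimum over no routings would be `0`; nonemptiness makes each index the load of an actual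
  -- routing `R'`.
  have : Nonempty (Routing (circulant n s)) := ⟨R⟩
  refine ⟨R, fun x y h => (hR x y h).1, ?_, ?_, ?_⟩
  · obtain ⟨t, τ, hrun, ht, hout⟩ := wp_routing (n := n) (s := s) (by omega) (by omega)
    refine ⟨t, τ, hrun, by simpa using ht, ?_⟩
    rw [hout, encode_eq R fun x y h => (hR x y h).1]
  · obtain ⟨R', hR'⟩ := ciInf_mem fun R : Routing (circulant n s) => R.maxEdgeLoad
    have h := (hfollow.approximation hn hs hsq R').1
    rw [edgeForwardingIndex, ← hR']
    have : 2 * (R.maxEdgeLoad : ℝ) ≤ 3 * R'.maxEdgeLoad := by exact_mod_cast h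
    simp only
    linarith
  · obtain ⟨R', hR'⟩ := ciInf_mem fun R : Routing (circulant n s) => R.maxArcLoad
    have h := (hfollow.approximation hn hs hsq R').2
    rw [arcForwardingIndex, ← hR']
    have : 2 * (R.maxArcLoad : ℝ) ≤ 3 * R'.maxArcLoad := by exact_mod_cast h
    simp only
    linarith
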